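/- A dimension function is a non-decreasing continuous function $h:[0,\infty)\to[0,\infty)$ with $h(0)=0$. For $A\subseteq\mathbb{R}^2$ let $$\mathcal{H}^h(A)=\sup_{\delta>0}\ \inf\Big\{\sum_i h(\operatorname{diam}A_i)\ :\ A\subseteq\bigcup_{i=1}^\infty A_i,\ \operatorname{diam}A_i<\delta\Big\}$$ be the associated Hausdorff measure. A set $E\subseteq\mathbb{R}^2$ is called an $F_h$-set if for every direction $e$ in the unit circle there is a line segment $\ell_e$ in the direction of $e$ such that $\mathcal{H}^h(\ell_e\cap E)>0$. **Theorem.** Let $\mathfrak{h}$ be a dimension function with $\mathfrak{h}(x)=\dfrac{1}{\log(1/x)}$ for all sufficiently small $x>0$. Then there is an $F_{\mathfrak{h}}$-set $E\subseteq\mathbb{R}^2$ with $\dim_H(E)\le\frac12$. Moreover, the value $\frac12$ is sharp: every $F_{\mathfrak{h}}$-set $E\subseteq\mathbb{R}^2$ satisfies $\dim_H(E)\ge\frac12$. -/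

import Mathlib

open MeasureTheory Topology Filter
open scoped NNReal ENNReal

/-- A dimension function: a non-decreasing continuous `h : [0, ∞) → [0, ∞)` with `h 0 = 0`. -/
structure IsDimensionFunction (h : ℝ≥0 → ℝ≥0) : Prop where
  mono : Monotone h
  cont : Continuous h
  zero : h 0 = 0

/-- The function `h` is given by `x ↦ 1 / log (1 / x)` for all sufficiently small `x > 0`.
(The formula does not define a function on all of `[0, ∞)`; Hausdorff measures depend only on the
values of `h` near `0`.) -/
def IsInverseLogNearZero (h : ℝ≥0 → ℝ≥0) : Prop :=
  ∀ᶠ x : ℝ≥0 in 𝓝[>] 0, (h x : ℝ) = 1 / Real.log (1 / (x : ℝ))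

/-- The generalized Hausdorff measure `ℋ^h` on the Euclidean plane, as an outer measure defined on
all subsets: `ℋ^h(E) = sup_{δ > 0} inf {∑ i, h (diam (E i)) : E ⊆ ⋃ i, E i, diam (E i) ≤ δ}`.
Sets of infinite diameter never occur in the coverings for finite `δ`, so the value of the gauge
at `∞` is irrelevant. -/
noncomputable def hausdorffOuterMeasure (h : ℝ≥0 → ℝ≥0) :
    OuterMeasure (EuclideanSpace ℝ (Fin 2)) :=
  OuterMeasure.mkMetric fun r : ℝ≥0∞ => (h r.toNNReal : ℝ≥0∞)

/-- `E ⊆ ℝ²` is an `F_h`-set: for every direction `e` in the unit circle there is a line segment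
`ℓ_e` in the direction of `e` such that `ℋ^h(ℓ_e ∩ E) > 0`. -/
def IsFurstenbergSet (h : ℝ≥0 → ℝ≥0) (E : Set (EuclideanSpace ℝ (Fin 2))) : Prop :=
  ∀ e ∈ Metric.sphere (0 : EuclideanSpace ℝ (Fin 2)) 1,
    ∃ (a : EuclideanSpace ℝ (Fin 2)) (L : ℝ), 0 < L ∧
      0 < hausdorffOuterMeasure h (segment ℝ a (a + L • e) ∩ E)

/-- There is a dimension function given by `1 / log (1 / x)` near `0`. -/
theorem exists_isDimensionFunction_inverseLog :
    ∃ h : ℝ≥0 → ℝ≥0, IsDimensionFunction h ∧ IsInverseLogNearZero h := by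
  set c : ℝ := Real.exp (-1) with hc
  have hc0 : 0 < c := Real.exp_pos _
  have key : ∀ x : ℝ, 0 < x → x ≤ c → 1 ≤ Real.log (1 / x) := by
    intro x hx hxc
    rw [one_div, Real.log_inv]
    have := Real.log_le_log hx hxc
    rw [hc, Real.log_exp] at this
    linarith
  have hmin : ∀ x : ℝ≥0, x ≠ 0 → 0 < min (x : ℝ) c := fun x hx =>
    lt_min (by positivity) hc0
  refine ⟨fun x => (1 / Real.log (1 / min (x : ℝ) c)).toNNReal, ⟨?_, ?_, ?_⟩, ?_⟩
  · intro x y hxy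
    apply Real.toNNReal_le_toNNReal
    rcases eq_or_ne x 0 with rfl | hx
    · rcases eq_or_ne y 0 with rfl | hy
      · exact le_rfl
      · have := key _ (hmin y hy) (min_le_right _ _)
        have h0 : min ((0 : ℝ≥0) : ℝ) c = 0 := by simp [hc0.le]
        rw [h0]
        simp only [div_zero, Real.log_zero]
        positivity
    · have hy : y ≠ 0 := (lt_of_lt_of_le (pos_iff_ne_zero.2 hx) hxy).ne'
      have h1 := key _ (hmin y hy) (min_le_right _ _)
      have hle : min (x : ℝ) c ≤ min (y : ℝ) c := min_le_min_right _ (by exact_mod_cast hxy)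
      apply one_div_le_one_div_of_le (by linarith)
      apply Real.log_le_log (one_div_pos.2 (hmin y hy))
      exact one_div_le_one_div_of_le (hmin x hx) hle
  · refine continuous_real_toNNReal.comp (continuous_iff_continuousAt.2 fun x => ?_)
    rcases eq_or_ne x 0 with rfl | hx
    · have hlim : Tendsto (fun t : ℝ => 1 / Real.log (1 / t)) (𝓝 0) (𝓝 0) := by
        have h' : ContinuousAt (fun t : ℝ => 1 / Real.log (1 / t)) 0 := by
          rw [continuousAt_iff_punctured_nhds]
          simp only [one_div, Real.log_inv, Real.log_zero, inv_zero]
          exact (tendsto_neg_atBot_atTop.comp Real.tendsto_log_nhdsNE_zero).inv_tendsto_atTop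
        simpa [ContinuousAt] using h'
      have hcont : Tendsto (fun x : ℝ≥0 => min (x : ℝ) c) (𝓝 0) (𝓝 0) := by
        have : Continuous (fun x : ℝ≥0 => min (x : ℝ) c) := by fun_prop
        simpa [hc0.le] using this.tendsto 0
      have h0 : (1 / Real.log (1 / min ((0 : ℝ≥0) : ℝ) c)) = 0 := by simp [hc0.le]
      rw [ContinuousAt, h0]
      exact hlim.comp hcont
    · have h1 := key _ (hmin x hx) (min_le_right _ _)
      have h2 := (hmin x hx).ne'
      have h3 : ContinuousAt (fun x : ℝ≥0 => min (x : ℝ) c) x := by fun_prop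
      refine continuousAt_const.div ((continuousAt_const.div h3 h2).log ?_) (by linarith)
      exact one_div_ne_zero h2
  · simp [hc0.le]
  · have hmem : ∀ᶠ x : ℝ≥0 in 𝓝[>] 0, (x : ℝ) < c :=
      eventually_nhdsWithin_of_eventually_nhds
        (NNReal.continuous_coe.tendsto 0 |>.eventually_lt_const (by simpa using hc0))
    filter_upwards [hmem, self_mem_nhdsWithin] with x hx hx0
    have hx0' : 0 < (x : ℝ) := by exact_mod_cast hx0
    have := key x hx0' hx.le
    rw [min_eq_left hx.le, Real.coe_toNNReal _ (by positivity)]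

/-!
Lower bound. Suppose `dim E < 1/2` and cover `E` infinitely often by sets `U i` of diameter at most
`w i ^ (2 + 2 * η)`, where `∑ w i < ∞`. Group the `w i` into classes on which `-log w` is comparable
to `q ^ j`, with `q = 1 + η`. The slopes of the lines that join two given sets of class `j` at
distance at least `exp (-η q ^ j)` have measure at most a multiple of `w i * w k`, which is summable
over pairs. By Borel–Cantelli, for almost every slope `t` and all large `j`, every line of slope `t`
meets the union of class `j` in a set of diameter at most `exp (-η q ^ j)`. As `h x` is of order
`1 / log (1 / x)`, the sum of the `h (exp (-η q ^ j))` is dominated by a convergent geometric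
series, so `E` is `ℋ^h`-null on every such line.

Upper bound. The projective map `(x, z) ↦ (1 / (x + √2), z / (x + √2))` takes the lines
`z = α x + (s + √2 α)` to lines of slope `s` and does not increase Hausdorff dimension on `x ≥ 0`.
On these lines take the points whose `x` has its nonzero base 4 digits in sparse blocks. At least
`log₂ k - 1` of the positions below `k` are free, so a number `y` whose binary digits are written
there is determined up to `O(1 / k)` by `x` up to `O(4 ^ (-k))`: this makes the `ℋ^h`-measure
positive. At the end of a long gap, at position `Q`, all such `x` are within `4 ^ (-Q)` of multiples
of `Q ^ (-4)`. Since `√2` is badly approximable, for every `s` the numbers `α` for which both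
coefficients `α` and `s + √2 α` are within `4 ^ (-Q)` of multiples of `1 / (Q 2 ^ Q)` form an open
set that becomes dense as `Q` grows, and by Baire's theorem some `α` works for infinitely many of
these `Q`. The points then lie within `O(4 ^ (-Q))` of a grid of `O(Q ^ 9 * 2 ^ Q)` points that does
not depend on `s`, whence dimension at most `1/2`.
-/

open Asymptotics

theorem exists_pos_nnreal_ge_tsum_lt {ι : Type*} [Countable ι] {f : ι → ℝ≥0∞} {ε : ℝ≥0∞}
    (hf : ∑' i, f i < ε) :
    ∃ w : ι → ℝ≥0, (∀ i, 0 < w i) ∧ (∀ i, f i ≤ w i) ∧ ∑' i, (w i : ℝ≥0∞) < ε := by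
  obtain ⟨δ, hδ, hδsum⟩ := ENNReal.exists_pos_sum_of_countable (tsub_pos_iff_lt.2 hf).ne' ι
  have hfin (i : ι) : f i ≠ ∞ := ENNReal.ne_top_of_tsum_ne_top hf.ne_top i
  refine ⟨fun i ↦ (f i).toNNReal + δ i, fun i ↦ add_pos_of_nonneg_of_pos zero_le (hδ i),
    fun i ↦ ?_, ?_⟩
  · rw [ENNReal.coe_add, ENNReal.coe_toNNReal (hfin i)]
    exact le_self_add
  · simp only [ENNReal.coe_add, ENNReal.coe_toNNReal (hfin _)]
    rw [ENNReal.tsum_add, add_comm]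
    exact lt_tsub_iff_right.1 hδsum

section HausdorffMeasure

variable {X : Type*} [EMetricSpace X]

theorem mkMetric_limsup_cofinite_eq_zero {ι : Type*} [Countable ι] {m : ℝ≥0∞ → ℝ≥0∞}
    {U : ι → Set X} (hdiam : Tendsto (fun i ↦ Metric.ediam (U i)) cofinite (𝓝 0))
    (hsum : ∑' i, m (Metric.ediam (U i)) ≠ ∞) :
    OuterMeasure.mkMetric m (limsup U cofinite) = 0 := by
  borelize X
  let r (s : Finset ι) : ℝ≥0∞ := ⨆ i : {i // i ∉ s}, Metric.ediam (U i)
  have hr : Tendsto r atTop (𝓝 0) := by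
    refine ENNReal.tendsto_nhds_zero.2 fun ε hε ↦ ?_
    have hfin : {i | ¬ Metric.ediam (U i) ≤ ε}.Finite := ENNReal.tendsto_nhds_zero.1 hdiam ε hε
    filter_upwards [eventually_ge_atTop hfin.toFinset] with s hs
    refine iSup_le fun i ↦ ?_
    by_contra hi
    exact i.2 (hs (hfin.mem_toFinset.2 hi))
  have hcover (s : Finset ι) : limsup U cofinite ⊆ ⋃ i : {i // i ∉ s}, U i := by
    intro x hx
    rw [cofinite.limsup_set_eq] at hx
    obtain ⟨i, hxi, his⟩ := hx.exists_notMem_finset s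
    exact Set.mem_iUnion.2 ⟨⟨i, his⟩, hxi⟩
  have hle := Measure.mkMetric_le_liminf_tsum (limsup U cofinite) r hr
    (fun s (i : {i // i ∉ s}) ↦ U i)
    (Eventually.of_forall fun s i ↦ le_iSup (fun i : {i // i ∉ s} ↦ Metric.ediam (U i)) i)
    (Eventually.of_forall hcover) m
  rwa [← OuterMeasure.coe_mkMetric, (ENNReal.tendsto_tsum_compl_atTop_zero hsum).liminf_eq,
    nonpos_iff_eq_zero] at hle

theorem volume_le_mul_mkMetric_image {m : ℝ≥0∞ → ℝ≥0∞} (hm : MonotoneOn m (Set.Iio ∞))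
    {G : ℝ → X} {T : Set ℝ} {C : ℝ≥0} (hC : C ≠ 0)
    (hG : ∀ y ∈ T, ∀ y' ∈ T, edist y y' ≤ C * m (edist (G y) (G y'))) :
    volume T ≤ C * OuterMeasure.mkMetric m (G '' T) := by
  have hC' : (C : ℝ≥0∞) ≠ 0 := ENNReal.coe_ne_zero.2 hC
  let μ : OuterMeasure X :=
    (C : ℝ≥0∞)⁻¹ • OuterMeasure.map G (OuterMeasure.restrict T volume.toOuterMeasure)
  have hμ (A : Set X) : μ A = (C : ℝ≥0∞)⁻¹ * volume (G ⁻¹' A ∩ T) := by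
    simp [μ]
  have hle : μ ≤ OuterMeasure.mkMetric m := by
    refine OuterMeasure.le_mkMetric m μ 1 one_pos fun A hA ↦ ?_
    rw [hμ, ENNReal.inv_mul_le_iff hC' ENNReal.coe_ne_top]
    refine (Real.volume_le_diam _).trans (Metric.ediam_le ?_)
    rintro y ⟨hyA, hyT⟩ y' ⟨hyA', hyT'⟩
    have hdist : edist (G y) (G y') ≤ Metric.ediam A := Metric.edist_le_ediam_of_mem hyA hyA'
    have hfin := hA.trans_lt ENNReal.one_lt_top
    exact (hG y hyT y' hyT').trans (by gcongr; exact hm (hdist.trans_lt hfin) hfin hdist)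
  have happly := hle (G '' T)
  rwa [hμ, Set.inter_eq_right.2 (Set.subset_preimage_image G T),
    ENNReal.inv_mul_le_iff hC' ENNReal.coe_ne_top] at happly

variable [MeasurableSpace X] [BorelSpace X]

theorem hausdorffMeasure_limsup_cofinite_eq_zero {ι : Type*} [Countable ι] {s : ℝ} (hs : 0 < s)
    {U : ι → Set X} (hsum : ∑' i, Metric.ediam (U i) ^ s ≠ ∞) :
    μH[s] (limsup U cofinite) = 0 := by
  have hdiam : Tendsto (fun i ↦ Metric.ediam (U i)) cofinite (𝓝 0) := by
    have hpow := (ENNReal.tendsto_cofinite_zero_of_tsum_ne_top hsum).ennrpow_const s⁻¹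
    simpa only [ENNReal.rpow_rpow_inv hs.ne', ENNReal.zero_rpow_of_pos (inv_pos.2 hs)] using hpow
  have hzero := mkMetric_limsup_cofinite_eq_zero (m := (· ^ s)) hdiam hsum
  rwa [OuterMeasure.coe_mkMetric] at hzero

theorem exists_cover_tsum_ediam_rpow_lt {E : Set X} {s : ℝ} (hs : 0 < s) (hE : μH[s] E = 0)
    {ε : ℝ≥0∞} (hε : ε ≠ 0) :
    ∃ U : ℕ → Set X, E ⊆ ⋃ i, U i ∧ ∑' i, Metric.ediam (U i) ^ s < ε := by
  have hlt : ⨅ (t : ℕ → Set X) (_ : E ⊆ ⋃ n, t n) (_ : ∀ n, Metric.ediam (t n) ≤ 1),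
      ∑' n, ⨆ _ : (t n).Nonempty, Metric.ediam (t n) ^ s < ε := by
    refine lt_of_le_of_lt ?_ (pos_iff_ne_zero.2 hε)
    rw [← hE, Measure.hausdorffMeasure_apply]
    exact le_iSup₂ (f := fun (r : ℝ≥0∞) (_ : 0 < r) ↦
      ⨅ (t : ℕ → Set X) (_ : E ⊆ ⋃ n, t n) (_ : ∀ n, Metric.ediam (t n) ≤ r),
        ∑' n, ⨆ _ : (t n).Nonempty, Metric.ediam (t n) ^ s) 1 one_pos
  simp only [iInf_lt_iff] at hlt
  obtain ⟨U, hEU, -, hsum⟩ := hlt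
  refine ⟨U, hEU, (ENNReal.tsum_le_tsum fun i ↦ ?_).trans_lt hsum⟩
  rcases (U i).eq_empty_or_nonempty with hU | hU
  · simp [hU, hs]
  · simp [hU]

theorem exists_subset_limsup_tsum_ediam_rpow_lt {E : Set X} {s : ℝ} (hs : 0 < s)
    (hE : μH[s] E = 0) {ε : ℝ≥0∞} (hε : ε ≠ 0) :
    ∃ U : ℕ × ℕ → Set X, E ⊆ limsup U cofinite ∧ ∑' p, Metric.ediam (U p) ^ s < ε := by
  obtain ⟨δ, hδ, hδsum⟩ := ENNReal.exists_pos_sum_of_countable hε ℕ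
  choose U hEU hU using fun n ↦
    exists_cover_tsum_ediam_rpow_lt hs hE (ENNReal.coe_ne_zero.2 (hδ n).ne')
  refine ⟨fun p ↦ U p.1 p.2, fun x hx ↦ ?_, ?_⟩
  · choose i hi using fun n ↦ Set.mem_iUnion.1 (hEU n hx)
    rw [cofinite.limsup_set_eq]
    exact Set.infinite_of_injective_forall_mem (f := fun n ↦ (n, i n))
      (fun _ _ hmn ↦ (Prod.ext_iff.1 hmn).1) hi
  · rw [ENNReal.tsum_prod (f := fun n i ↦ Metric.ediam (U n i) ^ s)]
    exact (ENNReal.tsum_le_tsum fun n ↦ (hU n).le).trans_lt hδsum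

end HausdorffMeasure

theorem dist_le_rpow_inv_of_ediam_rpow_le {X : Type*} [PseudoMetricSpace X] {A : Set X} {s : ℝ}
    (hs : 0 < s) {a : ℝ≥0} (hA : Metric.ediam A ^ s ≤ a) {x y : X} (hx : x ∈ A) (hy : y ∈ A) :
    dist x y ≤ (a : ℝ) ^ s⁻¹ := by
  have hedist : edist x y ^ s ≤ a :=
    (ENNReal.rpow_le_rpow (Metric.edist_le_ediam_of_mem hx hy) hs.le).trans hA
  rw [edist_nndist, ← ENNReal.coe_rpow_of_nonneg _ hs.le, ENNReal.coe_le_coe] at hedist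
  rw [Real.le_rpow_inv_iff_of_pos dist_nonneg a.coe_nonneg hs, dist_nndist]
  exact_mod_cast hedist

theorem exists_weighted_cofinite_cover {X : Type*} [MetricSpace X] {E : Set X} {s : ℝ≥0}
    (hs : 0 < s) (hE : dimH E < s) :
    ∃ (U : ℕ × ℕ → Set X) (w : ℕ × ℕ → ℝ≥0), E ⊆ limsup U cofinite ∧ (∀ i, 0 < w i) ∧
      (∀ i, 1 ≤ -Real.log (w i)) ∧ ∑' i, (w i : ℝ≥0∞) ≠ ∞ ∧
      ∀ i, ∀ x ∈ U i, ∀ y ∈ U i, dist x y ≤ (w i : ℝ) ^ (s : ℝ)⁻¹ := by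
  borelize X
  obtain ⟨U, hEU, hUsum⟩ := exists_subset_limsup_tsum_ediam_rpow_lt (NNReal.coe_pos.2 hs)
    (hausdorffMeasure_of_dimH_lt hE) (ENNReal.ofReal_pos.2 (Real.exp_pos (-1))).ne'
  obtain ⟨w, hw, hUw, hwsum⟩ := exists_pos_nnreal_ge_tsum_lt hUsum
  refine ⟨U, w, hEU, hw, fun i ↦ ?_, hwsum.ne_top, fun i x hx y hy ↦
    dist_le_rpow_inv_of_ediam_rpow_le (NNReal.coe_pos.2 hs) (hUw i) hx hy⟩
  have hwi : (w i : ℝ≥0∞) ≤ ENNReal.ofReal (Real.exp (-1)) := (ENNReal.le_tsum i).trans hwsum.le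
  rw [← ENNReal.ofReal_coe_nnreal, ENNReal.ofReal_le_ofReal_iff (Real.exp_pos _).le] at hwi
  rw [le_neg]
  exact (Real.log_le_iff_le_exp (NNReal.coe_pos.2 (hw i))).2 hwi

theorem hausdorffMeasure_eq_zero_of_frequently_exists_dist_le {X : Type*} [MetricSpace X]
    [MeasurableSpace X] [BorelSpace X] {F : Set X} {s : ℝ} (hs : 0 < s) {N : ℕ → Finset X}
    {r : ℕ → ℝ} (hr : ∀ n, 0 ≤ r n) (hsum : Summable fun n ↦ (N n).card * r n ^ s)
    (hF : ∀ x ∈ F, ∃ᶠ n in atTop, ∃ a ∈ N n, dist x a ≤ r n) : μH[s] F = 0 := by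
  let U (i : Σ n, N n) : Set X := Metric.closedBall i.2 (r i.1)
  have hball (i : Σ n, N n) : Metric.ediam (U i) ^ s ≤ ENNReal.ofReal ((2 * r i.1) ^ s) := by
    rw [← ENNReal.ofReal_rpow_of_nonneg (mul_nonneg two_pos.le (hr _)) hs.le]
    gcongr
    rw [ENNReal.ofReal_mul two_pos.le, ENNReal.ofReal_ofNat,
      show U i = _ from (Metric.closedEBall_ofReal (hr _)).symm]
    exact Metric.ediam_closedEBall_le
  have hU : ∑' i, Metric.ediam (U i) ^ s ≠ ∞ := by
    refine ne_top_of_le_ne_top (hsum.mul_left (2 ^ s)).tsum_ofReal_ne_top ?_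
    refine (ENNReal.tsum_le_tsum hball).trans_eq ?_
    rw [ENNReal.tsum_sigma' (fun i : Σ n, N n ↦ ENNReal.ofReal ((2 * r i.1) ^ s))]
    refine tsum_congr fun n ↦ ?_
    dsimp only
    rw [tsum_fintype, Finset.sum_const, Finset.card_univ, Fintype.card_coe, nsmul_eq_mul,
      Real.mul_rpow two_pos.le (hr n), mul_left_comm, ENNReal.ofReal_mul (Nat.cast_nonneg _),
      ENNReal.ofReal_natCast]
  refine measure_mono_null (fun x hx ↦ ?_) (hausdorffMeasure_limsup_cofinite_eq_zero hs hU)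
  rw [cofinite.limsup_set_eq]
  refine Set.Infinite.of_image Sigma.fst
    ((Nat.frequently_atTop_iff_infinite.1 (hF x hx)).mono fun n hn ↦ ?_)
  obtain ⟨a, ha, hxa⟩ := hn
  exact ⟨⟨n, a, ha⟩, hxa, rfl⟩

local notation "ℝ²" => EuclideanSpace ℝ (Fin 2)

section Directions

variable {h : ℝ≥0 → ℝ≥0} {E : Set ℝ²} {v : ℝ²}

/-- The set `E` meets some segment in direction `v` in positive `ℋ^h`-measure. The vector `v` is
not normalised: `IsFurstenbergSet h E` asks for this for all unit vectors. -/
def IsFurstenbergDirection (h : ℝ≥0 → ℝ≥0) (E : Set ℝ²) (v : ℝ²) : Prop :=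
  ∃ (a : ℝ²) (L : ℝ), 0 < L ∧ 0 < hausdorffOuterMeasure h (segment ℝ a (a + L • v) ∩ E)

theorem IsFurstenbergDirection.mono {E' : Set ℝ²} (hE : IsFurstenbergDirection h E v)
    (hEE' : E ⊆ E') : IsFurstenbergDirection h E' v := by
  obtain ⟨a, L, hL, hpos⟩ := hE
  exact ⟨a, L, hL, hpos.trans_le (measure_mono (Set.inter_subset_inter_right _ hEE'))⟩

theorem IsFurstenbergDirection.smul (hE : IsFurstenbergDirection h E v) {c : ℝ} (hc : c ≠ 0) :
    IsFurstenbergDirection h E (c • v) := by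
  obtain ⟨a, L, hL, hpos⟩ := hE
  rcases hc.lt_or_gt with hneg | hpos'
  · refine ⟨a + L • v, L / -c, div_pos hL (neg_pos.2 hneg), ?_⟩
    have hend : a + L • v + (L / -c) • c • v = a := by
      rw [smul_smul, div_neg, neg_mul, div_mul_cancel₀ L hc, neg_smul, add_neg_cancel_right]
    rwa [hend, segment_symm]
  · refine ⟨a, L / c, div_pos hL hpos', ?_⟩
    rwa [smul_smul, div_mul_cancel₀ L hc]

theorem IsFurstenbergDirection.image (hE : IsFurstenbergDirection h E v) (g : ℝ² ≃ₗᵢ[ℝ] ℝ²) :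
    IsFurstenbergDirection h (g '' E) (g v) := by
  obtain ⟨a, L, hL, hpos⟩ := hE
  refine ⟨g a, L, hL, ?_⟩
  have hsegment : g '' segment ℝ a (a + L • v) = segment ℝ (g a) (g a + L • g v) := by
    simpa using image_segment ℝ g.toLinearEquiv.toLinearMap.toAffineMap a (a + L • v)
  have hcomap := OuterMeasure.isometryEquiv_comap_mkMetric
    (fun r : ℝ≥0∞ ↦ (h r.toNNReal : ℝ≥0∞)) g.toIsometryEquiv
  rw [← hsegment, ← Set.image_inter g.injective]
  rwa [hausdorffOuterMeasure, ← hcomap] at hpos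

theorem isFurstenbergSet_iff :
    IsFurstenbergSet h E ↔ ∀ v ≠ 0, IsFurstenbergDirection h E v := by
  refine ⟨fun hE v hv ↦ ?_, fun hE e he ↦ hE e (ne_zero_of_mem_unit_sphere ⟨e, he⟩)⟩
  have hnorm : ‖v‖ ≠ 0 := norm_ne_zero_iff.2 hv
  have hunit : IsFurstenbergDirection h E (‖v‖⁻¹ • v) :=
    hE _ (by simp [norm_smul, inv_mul_cancel₀ hnorm])
  simpa only [smul_inv_smul₀ hnorm] using hunit.smul hnorm

/-- The line with equation `y = s * x + b`. -/
def lineWithSlope (s b : ℝ) : Set ℝ² := {p | p 1 = s * p 0 + b}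

theorem sub_eq_mul_sub_of_mem_lineWithSlope {s b : ℝ} {x y : ℝ²} (hx : x ∈ lineWithSlope s b)
    (hy : y ∈ lineWithSlope s b) : y 1 - x 1 = s * (y 0 - x 0) := by
  simp only [lineWithSlope, Set.mem_ofPred_eq] at hx hy
  linear_combination hy - hx

theorem IsFurstenbergDirection.exists_lineWithSlope {t : ℝ}
    (hE : IsFurstenbergDirection h E !₂[1, t]) :
    ∃ b, 0 < hausdorffOuterMeasure h (E ∩ lineWithSlope t b) := by
  obtain ⟨a, L, -, hpos⟩ := hE
  refine ⟨a 1 - t * a 0, hpos.trans_le (measure_mono ?_)⟩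
  rintro p ⟨hp, hpE⟩
  rw [segment_eq_image'] at hp
  obtain ⟨θ, -, rfl⟩ := hp
  refine ⟨hpE, ?_⟩
  simp only [lineWithSlope, Set.mem_ofPred_eq, add_sub_cancel_left, PiLp.add_apply,
    PiLp.smul_apply, Matrix.cons_val_zero, Matrix.cons_val_one, smul_eq_mul, mul_one]
  ring

theorem isFurstenbergDirection_of_lineWithSlope {s b x₀ x₁ : ℝ} (hx : x₀ < x₁)
    (hE : 0 < hausdorffOuterMeasure h (E ∩ lineWithSlope s b ∩ {p | p 0 ∈ Set.Icc x₀ x₁})) :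
    IsFurstenbergDirection h E !₂[1, s] := by
  refine ⟨!₂[x₀, s * x₀ + b], x₁ - x₀, sub_pos.2 hx, hE.trans_le (measure_mono ?_)⟩
  rintro p ⟨⟨hpE, hpline⟩, hp₀, hp₁⟩
  refine ⟨?_, hpE⟩
  rw [segment_eq_image']
  have hwidth : 0 < x₁ - x₀ := sub_pos.2 hx
  refine ⟨(p 0 - x₀) / (x₁ - x₀), ⟨div_nonneg (sub_nonneg.2 hp₀) hwidth.le,
    (div_le_one hwidth).2 (sub_le_sub_right hp₁ x₀)⟩, ?_⟩
  have hpline' : p 1 = s * p 0 + b := hpline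
  ext i
  fin_cases i
  · simp [div_mul_cancel₀ _ hwidth.ne']
  · simp only [Fin.mk_one, add_sub_cancel_left, PiLp.add_apply, PiLp.smul_apply,
      Matrix.cons_val_one, Matrix.cons_val_fin_one, smul_eq_mul, ← mul_assoc,
      div_mul_cancel₀ _ hwidth.ne', hpline']
    ring

end Directions

section LowerBound

/-- The slopes `t ∈ [-1, 1]` of lines through a point of `U` and a point of `V` whose abscissae
differ by more than `ρ`. -/
def slopesBetween (U V : Set ℝ²) (ρ : ℝ) : Set ℝ :=
  {t | t ∈ Set.Icc (-1) 1 ∧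
    ∃ x ∈ U, ∃ y ∈ V, ρ < |y 0 - x 0| ∧ y 1 - x 1 = t * (y 0 - x 0)}

theorem volume_slopesBetween_le {U V : Set ℝ²} {a b ρ : ℝ} (hρ : 0 < ρ)
    (ha : ∀ x ∈ U, ∀ x' ∈ U, dist x x' ≤ a) (hb : ∀ y ∈ V, ∀ y' ∈ V, dist y y' ≤ b) :
    volume (slopesBetween U V ρ) ≤ ENNReal.ofReal (2 * (a + b) / ρ) := by
  refine (Real.volume_le_diam _).trans (Metric.ediam_le_of_forall_dist_le ?_)
  rintro t ⟨-, x, hx, y, hy, hxy, hs⟩ t' ⟨ht', x', hx', y', hy', -, hs'⟩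
  have coord_le (u v : ℝ²) (i : Fin 2) : |u i - v i| ≤ dist u v := by
    rw [dist_eq_norm]
    simpa using PiLp.norm_apply_le (u - v) i
  have diff_le (i : Fin 2) : |(y i - y' i) - (x i - x' i)| ≤ b + a :=
    (abs_sub _ _).trans
      (add_le_add ((coord_le y y' i).trans (hb y hy y' hy'))
        ((coord_le x x' i).trans (ha x hx x' hx')))
  rw [Real.dist_eq, le_div_iff₀ hρ]
  calc |t - t'| * ρ ≤ |t - t'| * |y 0 - x 0| := by gcongr
    _ = |((y 1 - y' 1) - (x 1 - x' 1)) - t' * ((y 0 - y' 0) - (x 0 - x' 0))| := by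
        rw [← abs_mul]
        congr 1
        linear_combination hs' - hs
    _ ≤ |(y 1 - y' 1) - (x 1 - x' 1)| + |t'| * |(y 0 - y' 0) - (x 0 - x' 0)| := by
        rw [← abs_mul]
        exact abs_sub _ _
    _ ≤ (b + a) + 1 * (b + a) := by
        gcongr
        exacts [diff_le 1, abs_le.2 ht', diff_le 0]
    _ = 2 * (a + b) := by ring

/-- The hyperdyadic class of a weight `w < 1`: the `j` with `q ^ j ≤ -log w < q ^ (j + 1)`. -/
noncomputable def weightClass (q w : ℝ) : ℕ := ⌊Real.logb q (-Real.log w)⌋₊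

theorem pow_weightClass_le {q w : ℝ} (hq : 1 < q) (hw : 1 ≤ -Real.log w) :
    q ^ weightClass q w ≤ -Real.log w := by
  rw [← Real.rpow_natCast, ← Real.le_logb_iff_rpow_le hq (one_pos.trans_le hw)]
  exact Nat.floor_le (Real.logb_nonneg hq hw)

theorem neg_log_lt_pow_weightClass {q w : ℝ} (hq : 1 < q) (hw : 1 ≤ -Real.log w) :
    -Real.log w < q ^ (weightClass q w + 1) := by
  rw [← Real.rpow_natCast, ← Real.logb_lt_iff_lt_rpow hq (one_pos.trans_le hw), Nat.cast_succ]
  exact Nat.lt_floor_add_one _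

theorem rpow_le_exp_mul_mul {w v q η : ℝ} {j : ℕ} (hq : 0 < q) (hη : 0 < η) (hw : 0 < w)
    (hv : 0 < v) (hwj : q ^ j ≤ -Real.log w) (hvj : -Real.log v < q ^ (j + 1)) :
    w ^ (1 + q + η) ≤ Real.exp (-(η * q ^ j)) * (w * v) := by
  have hprod : w * v = Real.exp (Real.log w + Real.log v) := by
    rw [Real.exp_add, Real.exp_log hw, Real.exp_log hv]
  rw [Real.rpow_def_of_pos hw, hprod, ← Real.exp_add, Real.exp_le_exp]
  rw [pow_succ] at hvj
  nlinarith [mul_le_mul_of_nonneg_left hwj hη.le, mul_le_mul_of_nonneg_left hwj hq.le]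

variable {ι : Type*} {U : ι → Set ℝ²} {w : ι → ℝ≥0} {q η : ℝ}

/-- The pairs of sets of the same weight class for which `t` is the slope of a line through points
of both whose abscissae are far apart on the scale `exp (-(η * q ^ j))` of the class `j`. -/
def exceptionalPairs (U : ι → Set ℝ²) (w : ι → ℝ≥0) (q η t : ℝ) : Set (ι × ι) :=
  {p | weightClass q (w p.1) = weightClass q (w p.2) ∧
    t ∈ slopesBetween (U p.1) (U p.2) (Real.exp (-(η * q ^ weightClass q (w p.1))) / 2)}

theorem ae_finite_exceptionalPairs [Countable ι] (hq : 1 < q) (hη : 0 < η) (hw : ∀ i, 0 < w i)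
    (hlog : ∀ i, 1 ≤ -Real.log (w i)) (hsum : ∑' i, (w i : ℝ≥0∞) ≠ ∞)
    (hU : ∀ i, ∀ x ∈ U i, ∀ y ∈ U i, dist x y ≤ (w i : ℝ) ^ (1 + q + η)) :
    ∀ᵐ t, (exceptionalPairs U w q η t).Finite := by
  have hw' (i : ι) : (0 : ℝ) < w i := hw i
  have hvolume (p : ι × ι) :
      volume {t | p ∈ exceptionalPairs U w q η t} ≤ 8 * (w p.1 * w p.2) := by
    by_cases hp : weightClass q (w p.1) = weightClass q (w p.2)
    · have hpow := rpow_le_exp_mul_mul (one_pos.trans hq) hη (hw' p.1) (hw' p.2)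
        (pow_weightClass_le hq (hlog p.1)) (hp ▸ neg_log_lt_pow_weightClass hq (hlog p.2))
      have hpow' := rpow_le_exp_mul_mul (one_pos.trans hq) hη (hw' p.2) (hw' p.1)
        (hp ▸ pow_weightClass_le hq (hlog p.2)) (neg_log_lt_pow_weightClass hq (hlog p.1))
      refine (measure_mono fun t ht ↦ ht.2).trans ((volume_slopesBetween_le
        (half_pos (Real.exp_pos _)) (hU p.1) (hU p.2)).trans (ENNReal.ofReal_le_of_le_toReal ?_))
      rw [div_le_iff₀ (half_pos (Real.exp_pos _))]
      simp only [ENNReal.toReal_mul, ENNReal.toReal_ofNat, ENNReal.coe_toReal]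
      linarith
    · simp [exceptionalPairs, hp]
  refine ae_finite_setOfPred_mem (s := fun p ↦ {t | p ∈ exceptionalPairs U w q η t})
    (ne_top_of_le_ne_top ?_ (ENNReal.tsum_le_tsum hvolume))
  rw [ENNReal.tsum_mul_left, ENNReal.tsum_prod (f := fun i k ↦ (w i : ℝ≥0∞) * w k)]
  simp_rw [ENNReal.tsum_mul_left, ENNReal.tsum_mul_right]
  exact ENNReal.mul_ne_top ENNReal.ofNat_ne_top (ENNReal.mul_ne_top hsum hsum)

/-- The part of the line `y = t * x + b` covered by the sets `U i` of weight class `j`. -/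
def lineClassUnion (U : ι → Set ℝ²) (w : ι → ℝ≥0) (q t b : ℝ) (j : ℕ) : Set ℝ² :=
  lineWithSlope t b ∩ ⋃ i ∈ {i | weightClass q (w i) = j}, U i

theorem dist_le_two_mul_of_mem_lineWithSlope {t b : ℝ} (ht : t ∈ Set.Icc (-1) 1) {x y : ℝ²}
    (hx : x ∈ lineWithSlope t b) (hy : y ∈ lineWithSlope t b) :
    dist x y ≤ 2 * |y 0 - x 0| := by
  have ht2 : t ^ 2 ≤ 1 := (sq_le_one_iff_abs_le_one t).2 (abs_le.2 ht)
  rw [dist_comm, EuclideanSpace.dist_eq, Fin.sum_univ_two, Real.dist_eq, Real.dist_eq,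
    sub_eq_mul_sub_of_mem_lineWithSlope hx hy, Real.sqrt_le_left (by positivity),
    sq_abs, sq_abs, mul_pow, mul_pow, sq_abs]
  nlinarith [mul_le_mul_of_nonneg_right ht2 (sq_nonneg (y 0 - x 0)), sq_nonneg (y 0 - x 0)]

theorem eventually_ediam_lineClassUnion_le {t : ℝ} (ht : t ∈ Set.Icc (-1) 1)
    (hfin : (exceptionalPairs U w q η t).Finite) (b : ℝ) :
    ∀ᶠ j in atTop, Metric.ediam (lineClassUnion U w q t b j) ≤
      ENNReal.ofReal (Real.exp (-(η * q ^ j))) := by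
  have hfin' : ((fun p : ι × ι ↦ weightClass q (w p.1)) '' exceptionalPairs U w q η t).Finite :=
    hfin.image _
  rw [← Nat.cofinite_eq_atTop]
  filter_upwards [hfin'.compl_mem_cofinite] with j hj
  refine Metric.ediam_le_of_forall_dist_le ?_
  rintro x ⟨hx, hxU⟩ y ⟨hy, hyU⟩
  obtain ⟨i, hi, hxi⟩ := Set.mem_iUnion₂.1 hxU
  obtain ⟨k, hk, hyk⟩ := Set.mem_iUnion₂.1 hyU
  refine (dist_le_two_mul_of_mem_lineWithSlope ht hx hy).trans ?_
  by_contra! hfar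
  refine hj ⟨(i, k), ⟨hi.trans hk.symm, ht, x, hxi, y, hyk, ?_,
    sub_eq_mul_sub_of_mem_lineWithSlope hx hy⟩, hi⟩
  rw [show weightClass q (w i) = j from hi]
  linarith

theorem tendsto_weightClass_cofinite (hq : 1 < q) (hw : ∀ i, 0 < w i)
    (hlog : ∀ i, 1 ≤ -Real.log (w i)) (hsum : ∑' i, (w i : ℝ≥0∞) ≠ ∞) :
    Tendsto (fun i ↦ weightClass q (w i)) cofinite cofinite := by
  refine Tendsto.cofinite_of_finite_preimage_singleton fun j ↦ ?_
  refine (ENNReal.finite_const_le_of_tsum_ne_top hsum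
    (ε := ENNReal.ofReal (Real.exp (-q ^ (j + 1)))) (by simp [Real.exp_pos])).subset ?_
  rintro i rfl
  rw [Set.mem_ofPred_eq, ← ENNReal.ofReal_coe_nnreal]
  refine ENNReal.ofReal_le_ofReal ?_
  rw [← Real.le_log_iff_exp_le (NNReal.coe_pos.2 (hw i))]
  linarith [neg_log_lt_pow_weightClass hq (hlog i)]

theorem inter_limsup_subset_limsup_lineClassUnion {t b : ℝ}
    (hclass : Tendsto (fun i ↦ weightClass q (w i)) cofinite cofinite) :
    lineWithSlope t b ∩ limsup U cofinite ⊆ limsup (lineClassUnion U w q t b) cofinite := by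
  rintro x ⟨hx, hxU⟩
  rw [mem_limsup_iff_frequently_mem] at hxU ⊢
  exact hclass.frequently (hxU.mono fun i hi ↦ ⟨hx, Set.mem_iUnion₂.2 ⟨i, rfl, hi⟩⟩)

theorem hausdorffOuterMeasure_limsup_eq_zero {h : ℝ≥0 → ℝ≥0} (hmono : Monotone h)
    {V : ℕ → Set ℝ²} {r : ℕ → ℝ≥0} (hr : Tendsto r atTop (𝓝 0))
    (hsum : Summable fun j ↦ h (r j)) (hV : ∀ᶠ j in atTop, Metric.ediam (V j) ≤ r j) :
    hausdorffOuterMeasure h (limsup V cofinite) = 0 := by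
  refine mkMetric_limsup_cofinite_eq_zero ?_ (ENNReal.tsum_coe_ne_top_iff_summable.2 ?_)
  · rw [Nat.cofinite_eq_atTop]
    exact tendsto_of_tendsto_of_tendsto_of_le_of_le' tendsto_const_nhds
      (by simpa using ENNReal.tendsto_coe.2 hr) (Eventually.of_forall fun _ ↦ zero_le) hV
  · rw [← NNReal.summable_coe] at hsum ⊢
    refine hsum.of_norm_bounded_eventually_nat ?_
    filter_upwards [hV] with j hj
    rw [Real.norm_of_nonneg (NNReal.coe_nonneg _)]
    exact hmono (ENNReal.toNNReal_mono ENNReal.coe_ne_top hj)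

theorem tendsto_toNNReal_exp_neg_mul_pow (hq : 1 < q) (hη : 0 < η) :
    Tendsto (fun j : ℕ ↦ (Real.exp (-(η * q ^ j))).toNNReal) atTop (𝓝[>] 0) := by
  refine tendsto_nhdsWithin_iff.2
    ⟨?_, Eventually.of_forall fun j ↦ Real.toNNReal_pos.2 (Real.exp_pos _)⟩
  have hexp := Real.tendsto_exp_neg_atTop_nhds_zero.comp
    ((tendsto_pow_atTop_atTop_of_one_lt hq).const_mul_atTop hη)
  simpa using tendsto_real_toNNReal hexp

variable {h : ℝ≥0 → ℝ≥0} {E : Set ℝ²}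

theorem ae_hausdorffOuterMeasure_inter_lineWithSlope_eq_zero (hmono : Monotone h)
    (hsum : ∀ η > 0, ∀ q > 1, Summable fun j : ℕ ↦ h (Real.exp (-(η * q ^ j))).toNNReal)
    (hE : dimH E < 1 / 2) :
    ∀ᵐ t ∂volume.restrict (Set.Icc (-1) 1),
      ∀ b, hausdorffOuterMeasure h (E ∩ lineWithSlope t b) = 0 := by
  obtain ⟨s, hEs, hs⟩ := ENNReal.lt_iff_exists_nnreal_btwn.1 hE
  have hs₀ : 0 < s := ENNReal.coe_pos.1 (pos_of_gt hEs)
  have hs' : (2 : ℝ) < (s : ℝ)⁻¹ := by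
    have : (s : ℝ) < 1 / 2 := by simpa using ENNReal.toReal_strict_mono (by simp) hs
    rw [lt_inv_comm₀ two_pos (NNReal.coe_pos.2 hs₀)]
    linarith
  obtain ⟨η, hη, hsη⟩ : ∃ η > 0, (s : ℝ)⁻¹ = 1 + (1 + η) + η :=
    ⟨((s : ℝ)⁻¹ - 2) / 2, by linarith, by ring⟩
  have hq : 1 < 1 + η := by linarith
  obtain ⟨U, w, hEU, hw, hlog, hwsum, hU⟩ := exists_weighted_cofinite_cover hs₀ hEs
  rw [hsη] at hU
  filter_upwards [ae_restrict_mem measurableSet_Icc,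
    ae_restrict_of_ae (ae_finite_exceptionalPairs hq hη hw hlog hwsum hU)] with t ht hfin b
  refine measure_mono_null ?_ (hausdorffOuterMeasure_limsup_eq_zero hmono
    ((tendsto_toNNReal_exp_neg_mul_pow hq hη).mono_right nhdsWithin_le_nhds)
    (hsum η hη _ hq) (eventually_ediam_lineClassUnion_le ht hfin b))
  rw [Set.inter_comm]
  exact (Set.inter_subset_inter_right _ hEU).trans (inter_limsup_subset_limsup_lineClassUnion
    (tendsto_weightClass_cofinite hq hw hlog hwsum))

theorem summable_toNNReal_exp_of_isBigO
    (hlog : (fun x : ℝ≥0 ↦ (h x : ℝ)) =O[𝓝[>] 0] fun x ↦ 1 / Real.log (1 / (x : ℝ)))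
    (hη : 0 < η) (hq : 1 < q) :
    Summable fun j : ℕ ↦ h (Real.exp (-(η * q ^ j))).toNNReal := by
  have hgeom : Summable fun j : ℕ ↦ η⁻¹ * q⁻¹ ^ j :=
    (summable_geometric_of_lt_one (by positivity) (inv_lt_one_of_one_lt₀ hq)).mul_left _
  rw [← NNReal.summable_coe]
  refine summable_of_isBigO_nat hgeom ?_
  refine (hlog.comp_tendsto (tendsto_toNNReal_exp_neg_mul_pow hq hη)).congr_right fun j ↦ ?_
  rw [Function.comp_apply, Real.coe_toNNReal _ (Real.exp_pos _).le, one_div, one_div,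
    Real.log_inv, Real.log_exp, neg_neg, mul_inv, inv_pow]

theorem IsFurstenbergSet.one_half_le_dimH (hE : IsFurstenbergSet h E) (hmono : Monotone h)
    (hlog : (fun x : ℝ≥0 ↦ (h x : ℝ)) =O[𝓝[>] 0] fun x ↦ 1 / Real.log (1 / (x : ℝ))) :
    1 / 2 ≤ dimH E := by
  by_contra! hdim
  have hnull := ae_hausdorffOuterMeasure_inter_lineWithSlope_eq_zero hmono
    (fun η hη q hq ↦ summable_toNNReal_exp_of_isBigO hlog hη hq) hdim
  obtain ⟨t, -, hzero⟩ := Measure.exists_mem_of_measure_ne_zero_of_ae (by simp) hnull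
  have hne : (!₂[1, t] : ℝ²) ≠ 0 := fun h0 ↦ one_ne_zero (congrArg (fun v : ℝ² ↦ v 0) h0)
  obtain ⟨b, hb⟩ := (isFurstenbergSet_iff.1 hE _ hne).exists_lineWithSlope
  exact hb.ne' (hzero b)

end LowerBound

section Digits

variable {b : ℕ} {d d' : ℕ → Fin b}

theorem ofDigits_eq_head_add (d : ℕ → Fin b) :
    Real.ofDigits d = (b : ℝ)⁻¹ * ((d 0 : ℕ) + Real.ofDigits fun k ↦ d (k + 1)) := by
  rw [Real.ofDigits_eq_sum_add_ofDigits d 1]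
  simp only [Finset.sum_range_one, Real.ofDigitsTerm, zero_add, pow_one]
  ring

theorem sub_two_div_sq_le_ofDigits_sub (hhead : d' 0 < d 0) (hd' : (d' 1 : ℕ) ≤ 1) :
    ((b : ℝ) - 2) / b ^ 2 ≤ Real.ofDigits d - Real.ofDigits d' := by
  have hb : (0 : ℝ) < b := by exact_mod_cast (d 0).pos
  have hheads : ((d' 0 : ℕ) : ℝ) + 1 ≤ (d 0 : ℕ) := by exact_mod_cast hhead
  have hsecond : ((d' 1 : ℕ) : ℝ) ≤ 1 := by exact_mod_cast hd'
  have htail := Real.ofDigits_nonneg fun k ↦ d (k + 1)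
  have htail' := Real.ofDigits_le_one fun k ↦ d' (k + 1 + 1)
  have htail'_le : (Real.ofDigits fun k ↦ d' (k + 1)) ≤ (b : ℝ)⁻¹ * 2 := by
    rw [ofDigits_eq_head_add]
    exact mul_le_mul_of_nonneg_left (by linarith) (by positivity)
  rw [ofDigits_eq_head_add d, ofDigits_eq_head_add d', ← mul_sub,
    show ((b : ℝ) - 2) / b ^ 2 = (b : ℝ)⁻¹ * (1 - (b : ℝ)⁻¹ * 2) by field_simp]
  exact mul_le_mul_of_nonneg_left (by linarith) (by positivity)

theorem ofDigits_sub_ofDigits_of_forall_lt {k : ℕ} (hagree : ∀ i < k, d i = d' i) :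
    Real.ofDigits d - Real.ofDigits d' = ((b : ℝ) ^ k)⁻¹ *
      ((Real.ofDigits fun i ↦ d (i + k)) - Real.ofDigits fun i ↦ d' (i + k)) := by
  have hsum : ∑ i ∈ Finset.range k, Real.ofDigitsTerm d i =
      ∑ i ∈ Finset.range k, Real.ofDigitsTerm d' i :=
    Finset.sum_congr rfl fun i hi ↦ by
      simp only [Real.ofDigitsTerm, hagree i (Finset.mem_range.1 hi)]
  rw [Real.ofDigits_eq_sum_add_ofDigits d k, Real.ofDigits_eq_sum_add_ofDigits d' k, hsum]
  ring

theorem le_abs_ofDigits_sub_ofDigits {k : ℕ} (hagree : ∀ i < k, d i = d' i) (hne : d k ≠ d' k)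
    (hd : (d (k + 1) : ℕ) ≤ 1) (hd' : (d' (k + 1) : ℕ) ≤ 1) :
    ((b : ℝ) ^ k)⁻¹ * ((b - 2) / b ^ 2) ≤ |Real.ofDigits d - Real.ofDigits d'| := by
  wlog hlt : d' k < d k generalizing d d'
  · rw [abs_sub_comm]
    exact this (fun i hi ↦ (hagree i hi).symm) hne.symm hd' hd
      (lt_of_le_of_ne (not_lt.1 hlt) hne)
  rw [ofDigits_sub_ofDigits_of_forall_lt hagree, abs_mul, abs_of_nonneg (by positivity)]
  gcongr
  refine (sub_two_div_sq_le_ofDigits_sub ?_ ?_).trans (le_abs_self _)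
  · simpa only [zero_add] using hlt
  · simpa only [add_comm 1 k] using hd'

theorem exists_ofDigits_sum_eq_div (d : ℕ → Fin b) (n : ℕ) :
    ∃ u : ℕ, ∑ i ∈ Finset.range n, Real.ofDigitsTerm d i = u / (b : ℝ) ^ n := by
  have hb : (0 : ℝ) < b := by exact_mod_cast (d 0).pos
  induction n with
  | zero => exact ⟨0, by simp⟩
  | succ n ih =>
    obtain ⟨u, hu⟩ := ih
    refine ⟨u * b + d n, ?_⟩
    rw [Finset.sum_range_succ, hu, Real.ofDigitsTerm]
    push_cast
    field_simp
    ring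

theorem exists_nat_abs_ofDigits_sub_div_le {m n : ℕ} (hmn : m ≤ n)
    (hd : ∀ k, m ≤ k → k < n → (d k : ℕ) = 0) :
    ∃ u ≤ b ^ m, |Real.ofDigits d - u / (b : ℝ) ^ m| ≤ ((b : ℝ) ^ n)⁻¹ := by
  have hb : (0 : ℝ) < b := by exact_mod_cast (d 0).pos
  obtain ⟨u, hu⟩ := exists_ofDigits_sum_eq_div d m
  have hsum : ∑ i ∈ Finset.range n, Real.ofDigitsTerm d i = u / (b : ℝ) ^ m := by
    rw [← hu]
    refine (Finset.sum_subset (Finset.range_mono hmn) fun k hkn hkm ↦ ?_).symm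
    rw [Finset.mem_range] at hkn hkm
    rw [Real.ofDigitsTerm, hd k (not_lt.1 hkm) hkn, Nat.cast_zero, zero_mul]
  have hsplit := Real.ofDigits_eq_sum_add_ofDigits d n
  rw [hsum] at hsplit
  have htail : 0 ≤ Real.ofDigits fun i ↦ d (i + n) := Real.ofDigits_nonneg _
  refine ⟨u, ?_, ?_⟩
  · have hle : (u : ℝ) / b ^ m ≤ 1 :=
      (le_add_of_nonneg_right (by positivity)).trans (hsplit ▸ Real.ofDigits_le_one d)
    rw [div_le_one (by positivity)] at hle
    exact_mod_cast hle
  · rw [hsplit, add_sub_cancel_left, abs_of_nonneg (by positivity)]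
    exact mul_le_of_le_one_right (by positivity) (Real.ofDigits_le_one _)

open Classical in
/-- The base 4 digit sequence carrying the binary digits `d` in the positions of `S`, in order, and
zeros elsewhere. -/
noncomputable def spreadDigits (S : Set ℕ) (d : ℕ → Fin 2) (k : ℕ) : Fin 4 :=
  if k ∈ S then Fin.castLE (by norm_num) (d (Nat.count (· ∈ S) k)) else 0

/-- The number whose base 4 digits are the binary digits of `y`, spread out over the positions
of `S`. -/
noncomputable def spread (S : Set ℕ) (y : ℝ) : ℝ :=
  Real.ofDigits (spreadDigits S (Real.digits y 2))

variable {S : Set ℕ}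

theorem spread_mem_Icc (y : ℝ) : spread S y ∈ Set.Icc (0 : ℝ) 1 :=
  ⟨Real.ofDigits_nonneg _, Real.ofDigits_le_one _⟩

theorem spreadDigits_le_one (d : ℕ → Fin 2) (k : ℕ) : (spreadDigits S d k : ℕ) ≤ 1 := by
  unfold spreadDigits
  split_ifs
  · exact Nat.le_of_lt_succ (d _).isLt
  · exact Nat.zero_le 1

theorem spreadDigits_of_notMem (d : ℕ → Fin 2) {k : ℕ} (hk : k ∉ S) :
    (spreadDigits S d k : ℕ) = 0 := by
  rw [spreadDigits, if_neg hk, Fin.val_zero]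

open Classical in
theorem spreadDigits_nth (hS : S.Infinite) (d : ℕ → Fin 2) (l : ℕ) :
    spreadDigits S d (Nat.nth (· ∈ S) l) = Fin.castLE (by norm_num) (d l) := by
  rw [spreadDigits, if_pos (Nat.nth_mem_of_infinite (p := (· ∈ S)) hS l),
    Nat.count_nth_of_infinite (p := (· ∈ S)) hS l]

theorem spreadDigits_eq_of_lt_nth (hS : S.Infinite) {d d' : ℕ → Fin 2} {l k : ℕ}
    (hdd' : ∀ i < l, d i = d' i) (hk : k < Nat.nth (· ∈ S) l) :
    spreadDigits S d k = spreadDigits S d' k := by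
  classical
  unfold spreadDigits
  split_ifs with hkS
  · have hcount : Nat.count (· ∈ S) k < l :=
      (Nat.count_strict_mono hkS hk).trans_eq (Nat.count_nth_of_infinite (p := (· ∈ S)) hS l)
    rw [hdd' _ hcount]
  · rfl

open Classical in
theorem exists_le_abs_spread_sub (hS : S.Infinite) {y y' : ℝ} (hy : y ∈ Set.Ico (0 : ℝ) 1)
    (hy' : y' ∈ Set.Ico (0 : ℝ) 1) (hne : y ≠ y') :
    ∃ k : ℕ, |y - y'| ≤ (2 ^ Nat.count (· ∈ S) k)⁻¹ ∧
      ((4 : ℝ) ^ k)⁻¹ / 8 ≤ |spread S y - spread S y'| := by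
  have hex : ∃ l, Real.digits y 2 l ≠ Real.digits y' 2 l := by
    refine Function.ne_iff.1 fun heq ↦ hne ?_
    rw [← Real.ofDigits_digits one_lt_two hy, ← Real.ofDigits_digits one_lt_two hy', heq]
  have hagree (i : ℕ) (hi : i < Nat.find hex) : Real.digits y 2 i = Real.digits y' 2 i :=
    not_not.1 (Nat.find_min hex hi)
  refine ⟨Nat.nth (· ∈ S) (Nat.find hex), ?_, ?_⟩
  · rw [Nat.count_nth_of_infinite (p := (· ∈ S)) hS]
    simpa only [Real.ofDigits_digits one_lt_two hy, Real.ofDigits_digits one_lt_two hy',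
      Nat.cast_ofNat] using Real.abs_ofDigits_sub_ofDigits_le hagree
  · have hsep := le_abs_ofDigits_sub_ofDigits (b := 4)
      (d := spreadDigits S (Real.digits y 2)) (d' := spreadDigits S (Real.digits y' 2))
      (fun i hi ↦ spreadDigits_eq_of_lt_nth hS hagree hi)
      (by simpa only [spreadDigits_nth hS, ne_eq, Fin.castLE_inj] using Nat.find_spec hex)
      (spreadDigits_le_one _ _) (spreadDigits_le_one _ _)
    refine le_trans (le_of_eq ?_) hsep
    norm_num
    ring

end Digits

section FreePositions

/-- The iterated exponentials `1, 2, 2 ^ 2, 2 ^ 2 ^ 2, …`. -/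
def powTower : ℕ → ℕ
  | 0 => 1
  | i + 1 => 2 ^ powTower i

theorem powTower_strictMono : StrictMono powTower :=
  strictMono_nat_of_lt_succ fun _ ↦ Nat.lt_two_pow_self

theorem lt_powTower (i : ℕ) : i < powTower i := by
  induction i with
  | zero => exact Nat.one_pos
  | succ i ih => exact Nat.lt_of_le_of_lt ih (powTower_strictMono i.lt_succ_self)

theorem two_mul_powTower_le (i : ℕ) : 2 * powTower i ≤ powTower (i + 1) := by
  obtain ⟨n, hn⟩ := Nat.exists_eq_add_one.2 (i.zero_le.trans_lt (lt_powTower i))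
  rw [powTower, hn, pow_succ']
  exact Nat.mul_le_mul_left 2 Nat.lt_two_pow_self

/-- The positions of the free digits: the union of the blocks `[powTower i, 2 * powTower i)`. The
gap that follows such a block is exponentially longer than everything before it. -/
def freePositions : Set ℕ := {k | ∃ i, powTower i ≤ k ∧ k < 2 * powTower i}

/-- The scales `Q` such that the gap of `freePositions` ending at `Q` starts at `2 * log₂ Q`. -/
def gapScales : Set ℕ := Set.range fun i ↦ powTower (i + 1)

theorem notMem_freePositions {i k : ℕ} (hk : 2 * powTower i ≤ k) (hk' : k < powTower (i + 1)) :
    k ∉ freePositions := by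
  rintro ⟨j, hjk, hkj⟩
  have hji : j < i + 1 := powTower_strictMono.lt_iff_lt.1 (hjk.trans_lt hk')
  have := powTower_strictMono.monotone (Nat.lt_succ_iff.1 hji)
  omega

theorem infinite_freePositions : freePositions.Infinite := by
  refine Set.infinite_of_injective_forall_mem powTower_strictMono.injective fun i ↦ ⟨i, le_rfl, ?_⟩
  have := lt_powTower i
  omega

theorem infinite_gapScales : gapScales.Infinite :=
  Set.infinite_range_of_injective
    (powTower_strictMono.injective.comp (add_left_injective 1))

open Classical in
theorem powTower_le_count (i : ℕ) :
    powTower i ≤ Nat.count (· ∈ freePositions) (2 * powTower i) := by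
  rw [two_mul, Nat.count_add]
  refine le_add_left (Nat.count_iff_forall.2 fun k hk ↦ ⟨i, ?_, ?_⟩).ge <;> omega

open Classical in
theorem le_two_mul_two_pow_count (k : ℕ) : k ≤ 2 * 2 ^ Nat.count (· ∈ freePositions) k := by
  suffices hbelow : ∀ i, k < 2 * powTower i → k ≤ 2 * 2 ^ Nat.count (· ∈ freePositions) k from
    hbelow k ((lt_powTower k).trans_le (Nat.le_mul_of_pos_left _ two_pos))
  intro i hk
  induction i with
  | zero =>
    have := Nat.one_le_two_pow (n := Nat.count (· ∈ freePositions) k)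
    rw [powTower] at hk
    omega
  | succ i ih =>
    rcases lt_or_ge k (2 * powTower i) with hki | hki
    · exact ih hki
    · refine hk.le.trans (Nat.mul_le_mul_left 2 (Nat.pow_le_pow_right two_pos ?_))
      exact (powTower_le_count i).trans (Nat.count_monotone _ hki)

theorem exists_nat_abs_spread_sub_le {Q : ℕ} (hQ : Q ∈ gapScales) (y : ℝ) :
    ∃ u ≤ Q ^ 4, |spread freePositions y - u / (Q : ℝ) ^ 4| ≤ ((4 : ℝ) ^ Q)⁻¹ := by
  obtain ⟨i, rfl⟩ := hQ
  have hpow : (4 ^ (2 * powTower i) : ℕ) = powTower (i + 1) ^ 4 := by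
    rw [powTower, ← pow_mul, show 4 = 2 ^ 2 from rfl, ← pow_mul]
    ring
  have happrox := exists_nat_abs_ofDigits_sub_div_le (b := 4)
    (d := spreadDigits freePositions (Real.digits y 2)) (two_mul_powTower_le i)
    fun k hk hk' ↦ spreadDigits_of_notMem _ (notMem_freePositions hk hk')
  simp only [← Nat.cast_pow, hpow] at happrox
  simpa only [spread, Nat.cast_pow, Nat.cast_ofNat] using happrox

end FreePositions

section Diophantine

theorem sqrt_two_mem_Ioo : √2 ∈ Set.Ioo (1 : ℝ) (3 / 2) :=
  ⟨Real.one_lt_sqrt_two, (Real.sqrt_lt' (by norm_num)).2 (by norm_num)⟩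

theorem one_le_abs_two_mul_sq_sub_sq (c : ℤ) {m : ℤ} (hm : 0 < m) : 1 ≤ |2 * m ^ 2 - c ^ 2| := by
  refine Int.one_le_abs fun h0 ↦ irrational_sqrt_two ?_
  have : (0 : ℝ) < m := by exact_mod_cast hm
  have hsq : (2 : ℝ) = (c / m) ^ 2 := by
    rw [div_pow, eq_div_iff (by positivity)]
    exact_mod_cast sub_eq_zero.1 h0
  refine ⟨|c / m|, ?_⟩
  rw [hsq, Real.sqrt_sq_eq_abs]
  push_cast
  rfl

theorem one_le_four_mul_sq_mul_abs_sqrt_two_sub {c m : ℤ} (hm : 0 < m)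
    (hclose : |√2 - c / m| ≤ 1 / 2) : 1 ≤ 4 * (m : ℝ) ^ 2 * |√2 - c / m| := by
  have hm' : (0 : ℝ) < m := by exact_mod_cast hm
  obtain ⟨h1, h2⟩ := sqrt_two_mem_Ioo
  have hadd : |√2 + c / m| ≤ 4 := by
    rw [abs_le] at hclose ⊢
    constructor <;> linarith
  have hfactor : (2 * m ^ 2 - c ^ 2 : ℝ) = m ^ 2 * (√2 - c / m) * (√2 + c / m) := by
    have hsqrt : √2 ^ 2 = 2 := Real.sq_sqrt two_pos.le
    field_simp
    linear_combination -(m : ℝ) ^ 2 * hsqrt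
  calc (1 : ℝ) ≤ |2 * (m : ℝ) ^ 2 - (c : ℝ) ^ 2| := by
        exact_mod_cast one_le_abs_two_mul_sq_sub_sq c hm
    _ = m ^ 2 * |√2 - c / m| * |√2 + c / m| := by
      rw [hfactor, abs_mul, abs_mul, abs_of_pos (pow_pos hm' 2)]
    _ ≤ m ^ 2 * |√2 - c / m| * 4 := by gcongr
    _ = 4 * m ^ 2 * |√2 - c / m| := by ring

theorem exists_isCoprime_mul_abs_sqrt_two_sub_le {N : ℕ} (hN : 0 < N) :
    ∃ c m : ℤ, IsCoprime c m ∧ 0 < m ∧ m ≤ N ∧ (N : ℝ) ≤ 4 * m ∧ m * |√2 - c / m| ≤ 1 / N := by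
  obtain ⟨q, hq, hden⟩ := Real.exists_rat_abs_sub_le_and_den_le √2 hN
  have hden_pos : 0 < (q.den : ℤ) := by exact_mod_cast q.den_pos
  have hN' : (1 : ℝ) ≤ N := by exact_mod_cast hN
  have hm : (1 : ℝ) ≤ q.den := by exact_mod_cast q.den_pos
  have hdist : |√2 - q.num / (q.den : ℤ)| ≤ 1 / ((N + 1) * q.den) := by
    rwa [Int.cast_natCast, ← Rat.cast_def]
  refine ⟨q.num, q.den, Int.isCoprime_iff_nat_coprime.2 q.reduced, hden_pos,
    by exact_mod_cast hden, ?_, ?_⟩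
  · have hclose : |√2 - q.num / (q.den : ℤ)| ≤ 1 / 2 :=
      hdist.trans (one_div_le_one_div_of_le two_pos (by nlinarith))
    have hbad := (one_le_four_mul_sq_mul_abs_sqrt_two_sub hden_pos hclose).trans
      (mul_le_mul_of_nonneg_left hdist (by positivity))
    rw [Int.cast_natCast, mul_one_div, one_le_div (by positivity)] at hbad
    rw [Int.cast_natCast]
    nlinarith
  · calc _ ≤ (q.den : ℝ) * (1 / ((N + 1) * q.den)) := by
          exact mul_le_mul_of_nonneg_left hdist (by positivity)
      _ = 1 / (N + 1) := by field_simp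
      _ ≤ 1 / N := one_div_le_one_div_of_le (by positivity) (by linarith)

theorem exists_int_abs_add_mul_sub_le {c m : ℤ} (hcm : IsCoprime c m) (hm : 0 < m) (θ r : ℝ)
    (j₀ : ℤ) : ∃ j k : ℤ, j₀ ≤ j ∧ j < j₀ + m ∧
      |r + j * θ - k| ≤ 1 / (2 * m) + m * |θ - c / m| := by
  have hm' : (0 : ℝ) < m := by exact_mod_cast hm
  set t : ℝ := r + j₀ * θ with ht
  obtain ⟨a, b, hab⟩ := hcm
  set i : ℤ := (-round (t * m) * a) % m with hi
  have hi0 : 0 ≤ i := Int.emod_nonneg _ hm.ne'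
  have him : i < m := Int.emod_lt_of_pos _ hm
  obtain ⟨k, hk⟩ : m ∣ round (t * m) + i * c := by
    refine ⟨round (t * m) * b - c * ((-round (t * m) * a) / m), ?_⟩
    rw [hi, Int.emod_def]
    linear_combination (-round (t * m)) * hab
  have hk' : (round (t * m) : ℝ) = m * k - i * c := eq_sub_of_add_eq (by exact_mod_cast hk)
  refine ⟨j₀ + i, k, by omega, by omega, ?_⟩
  have hsplit : r + (j₀ + i : ℤ) * θ - k = (t * m - round (t * m)) / m + i * (θ - c / m) := by
    rw [hk', ht]
    push_cast
    field_simp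
    ring
  rw [hsplit]
  refine (abs_add_le _ _).trans (add_le_add ?_ ?_)
  · rw [abs_div, abs_of_pos hm', ← div_div]
    exact div_le_div_of_nonneg_right (abs_sub_round _) hm'.le
  · rw [abs_mul, abs_of_nonneg (by exact_mod_cast hi0)]
    exact mul_le_mul_of_nonneg_right (by exact_mod_cast him.le) (abs_nonneg _)

theorem exists_int_abs_add_mul_sqrt_two_sub_le {N : ℕ} (hN : 0 < N) (r : ℝ) (j₀ : ℤ) :
    ∃ j k : ℤ, j₀ ≤ j ∧ j < j₀ + N ∧ |r + j * √2 - k| ≤ 3 / N := by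
  obtain ⟨c, m, hcm, hm, hmN, hNm, happrox⟩ := exists_isCoprime_mul_abs_sqrt_two_sub_le hN
  obtain ⟨j, k, hj₀, hj, hjk⟩ := exists_int_abs_add_mul_sub_le hcm hm √2 r j₀
  have : (0 : ℝ) < m := by exact_mod_cast hm
  have hN' : (0 : ℝ) < N := by exact_mod_cast hN
  refine ⟨j, k, hj₀, by omega, ?_⟩
  calc |r + j * √2 - k| ≤ 1 / (2 * m) + m * |√2 - c / m| := hjk
    _ ≤ 2 / N + 1 / N := by
      gcongr ?_ + ?_
      rw [div_le_div_iff₀ (by positivity) hN']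
      linarith
    _ = 3 / N := by ring

/-- The intercepts `α` such that `α` and `s + √2 * α` are simultaneously approximable, up to
`4 ^ (-Q)`, by rationals with the common denominator `Q * 2 ^ Q`. -/
def approximableIntercepts (s : ℝ) (Q : ℕ) : Set ℝ :=
  {α | ∃ j k : ℤ, |α - j / (Q * 2 ^ Q)| < ((4 : ℝ) ^ Q)⁻¹ ∧
    |s + √2 * α - k / (Q * 2 ^ Q)| < ((4 : ℝ) ^ Q)⁻¹}

theorem isOpen_approximableIntercepts (s : ℝ) (Q : ℕ) : IsOpen (approximableIntercepts s Q) := by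
  simp only [approximableIntercepts, Set.ofPred_exists]
  refine isOpen_iUnion fun j ↦ isOpen_iUnion fun k ↦ IsOpen.and ?_ ?_
  · exact isOpen_lt (by fun_prop) continuous_const
  · exact isOpen_lt (by fun_prop) continuous_const

theorem exists_mem_approximableIntercepts_Ioo (s : ℝ) {Q : ℕ} (hQ : 3 < Q) {a b : ℝ}
    (hab : 1 / Q < b - a) : ∃ α ∈ Set.Ioo a b, α ∈ approximableIntercepts s Q := by
  have hQ' : (3 : ℝ) < Q := by exact_mod_cast hQ
  have hn : (0 : ℝ) < Q * 2 ^ Q := by positivity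
  obtain ⟨j, k, hj₀, hj, hjk⟩ := exists_int_abs_add_mul_sqrt_two_sub_le
    (pow_pos two_pos Q : 0 < 2 ^ Q) (Q * 2 ^ Q * s) (⌊a * (Q * 2 ^ Q)⌋ + 1)
  push_cast at hjk
  refine ⟨j / (Q * 2 ^ Q), ⟨?_, ?_⟩, j, k, ?_, ?_⟩
  · rw [lt_div_iff₀ hn]
    exact (Int.lt_floor_add_one _).trans_le (by exact_mod_cast hj₀)
  · have hj' : (j : ℝ) ≤ ⌊a * (Q * 2 ^ Q)⌋ + 2 ^ Q := by
      exact_mod_cast (by linarith : j ≤ ⌊a * (Q * 2 ^ Q)⌋ + (2 ^ Q : ℕ))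
    have hfloor := Int.floor_le (a * (Q * 2 ^ Q))
    have hwidth : (2 : ℝ) ^ Q < (b - a) * (Q * 2 ^ Q) := by
      rw [div_lt_iff₀ (by positivity)] at hab
      nlinarith [pow_pos (two_pos (α := ℝ)) Q]
    rw [div_lt_iff₀ hn]
    linarith
  · rw [sub_self, abs_zero]
    positivity
  · have hnum : s + √2 * (j / (Q * 2 ^ Q)) - k / (Q * 2 ^ Q) =
        (Q * 2 ^ Q * s + j * √2 - k) / (Q * 2 ^ Q) := by
      field_simp
    rw [hnum, abs_div, abs_of_pos hn, div_lt_iff₀ hn]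
    refine hjk.trans_lt ?_
    have hfour : ((4 : ℝ) ^ Q)⁻¹ * (Q * 2 ^ Q) = Q / 2 ^ Q := by
      rw [show (4 : ℝ) = 2 * 2 by norm_num, mul_pow]
      field_simp
    rw [hfour]
    gcongr

theorem exists_frequently_mem_approximableIntercepts {𝒬 : Set ℕ} (h𝒬 : 𝒬.Infinite) (s : ℝ) :
    ∃ α ∈ Set.Ioo (0 : ℝ) 1, ∃ᶠ Q in atTop, Q ∈ 𝒬 ∧ α ∈ approximableIntercepts s Q := by
  have hdense (m : ℕ) : Dense (⋃ Q ∈ 𝒬 ∩ Set.Ici m, approximableIntercepts s Q) := by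
    refine dense_iff_exists_between.2 fun a b hab ↦ ?_
    obtain ⟨P, hP⟩ := exists_nat_gt (1 / (b - a))
    obtain ⟨Q, hQ, hlt⟩ := h𝒬.exists_gt (max (max m 3) P)
    simp only [max_lt_iff] at hlt
    have hwidth : 1 / (Q : ℝ) < b - a :=
      (one_div_lt (sub_pos.2 hab) (by norm_cast; omega)).1 (hP.trans (by exact_mod_cast hlt.2))
    obtain ⟨α, hα, hαQ⟩ := exists_mem_approximableIntercepts_Ioo s hlt.1.2 hwidth
    exact ⟨α, Set.mem_biUnion ⟨hQ, hlt.1.1.le⟩ hαQ, hα⟩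
  have hbaire : Dense (⋂ m, ⋃ Q ∈ 𝒬 ∩ Set.Ici m, approximableIntercepts s Q) :=
    dense_iInter_of_isOpen_nat
      (fun m ↦ isOpen_biUnion fun Q _ ↦ isOpen_approximableIntercepts s Q) hdense
  obtain ⟨α, hα, hIoo⟩ := hbaire.exists_between (zero_lt_one (α := ℝ))
  refine ⟨α, hIoo, frequently_atTop.2 fun m ↦ ?_⟩
  obtain ⟨Q, ⟨hQ, hmQ⟩, hαQ⟩ := Set.mem_iUnion₂.1 (Set.mem_iInter.1 hα m)
  exact ⟨Q, hmQ, hQ, hαQ⟩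

end Diophantine

section ProjectiveChart

/-- The grid of the points `(u / M, v / D)` with `0 ≤ u ≤ M` and `|v| ≤ 7 * D`. -/
noncomputable def rationalGrid (M D : ℕ) : Finset (ℝ × ℝ) :=
  (Finset.range (M + 1)).image (fun u : ℕ ↦ (u : ℝ) / M) ×ˢ
    (Finset.Icc (-(7 * D : ℤ)) (7 * D)).image fun v : ℤ ↦ (v : ℝ) / D

theorem card_rationalGrid_le (M D : ℕ) : (rationalGrid M D).card ≤ (M + 1) * (14 * D + 1) := by
  rw [rationalGrid, Finset.card_product]
  refine Nat.mul_le_mul (Finset.card_image_le.trans (Finset.card_range _).le)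
    (Finset.card_image_le.trans ?_)
  rw [Int.card_Icc]
  omega

theorem exists_mem_rationalGrid_dist_le {x α b ε : ℝ} {M n u : ℕ} {j k : ℤ} (hM : 0 < M)
    (hn : 0 < n) (hε : ε ≤ 1) (hx : |x| ≤ 1) (hα : |α| ≤ 1) (hb : |b| ≤ 3) (hu : u ≤ M)
    (hxu : |x - u / M| ≤ ε) (hαj : |α - j / n| ≤ ε) (hbk : |b - k / n| ≤ ε) :
    ∃ a ∈ rationalGrid M (n * M), dist (x, α * x + b) a ≤ 3 * ε := by
  have hM' : (0 : ℝ) < M := by exact_mod_cast hM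
  have : (0 : ℝ) < n := by exact_mod_cast hn
  have huM : |(u : ℝ) / M| ≤ 1 := by
    rw [abs_of_nonneg (by positivity), div_le_one hM']
    exact_mod_cast hu
  have hclose : |α * x + b - (j * u + k * M : ℤ) / (n * M : ℕ)| ≤ 3 * ε := by
    have hsplit : α * x + b - (j * u + k * M : ℤ) / (n * M : ℕ) =
        α * (x - u / M) + (α - j / n) * (u / M) + (b - k / n) := by
      push_cast
      field_simp
      ring
    have hfst : |α * (x - u / M)| ≤ 1 * ε := by
      rw [abs_mul]
      exact mul_le_mul hα hxu (abs_nonneg _) zero_le_one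
    have hsnd : |(α - j / n) * (u / M)| ≤ ε * 1 := by
      rw [abs_mul]
      exact mul_le_mul hαj huM (abs_nonneg _) ((abs_nonneg _).trans hαj)
    rw [hsplit]
    linarith [abs_add_three (α * (x - u / M)) ((α - j / n) * (u / M)) (b - k / n)]
  have hnum : |((j * u + k * M : ℤ) : ℝ) / (n * M : ℕ)| ≤ 7 := by
    have hαx : |α * x| ≤ 1 * 1 := by
      rw [abs_mul]
      exact mul_le_mul hα hx (abs_nonneg _) zero_le_one
    have hswap := abs_sub_abs_le_abs_sub (((j * u + k * M : ℤ) : ℝ) / (n * M : ℕ)) (α * x + b)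
    rw [abs_sub_comm] at hswap
    linarith [abs_add_le (α * x) b]
  refine ⟨(u / M, (j * u + k * M : ℤ) / (n * M : ℕ)), ?_, ?_⟩
  · refine Finset.mem_product.2 ⟨Finset.mem_image.2 ⟨u, by simpa [Nat.lt_succ_iff] using hu, rfl⟩,
      Finset.mem_image.2 ⟨j * u + k * M, ?_, rfl⟩⟩
    rw [abs_div, Nat.abs_cast, div_le_iff₀ (by positivity)] at hnum
    rw [Finset.mem_Icc, ← abs_le]
    exact_mod_cast hnum
  · rw [Prod.dist_eq, Real.dist_eq, Real.dist_eq]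
    exact max_le (by linarith [abs_nonneg (x - u / M)]) hclose

theorem two_mul_rpow_neg_lt_one {σ : ℝ} (hσ : 1 / 2 < σ) : 2 * (4 : ℝ) ^ (-σ) < 1 :=
  calc 2 * (4 : ℝ) ^ (-σ) = 2 ^ (1 : ℝ) * ((2 : ℝ) ^ (2 : ℝ)) ^ (-σ) := by norm_num
    _ = 2 ^ (1 + 2 * -σ) := by rw [← Real.rpow_mul two_pos.le, ← Real.rpow_add two_pos]
    _ < 1 := Real.rpow_lt_one_of_one_lt_of_neg one_lt_two (by linarith)

theorem summable_card_rationalGrid_mul_rpow {σ : ℝ} (hσ : 1 / 2 < σ) :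
    Summable fun Q : ℕ ↦
      (rationalGrid (Q ^ 4) (Q * 2 ^ Q * Q ^ 4)).card * (3 * ((4 : ℝ) ^ Q)⁻¹) ^ σ := by
  have hgeom : Summable fun Q : ℕ ↦ (Q : ℝ) ^ 9 * (2 * (4 : ℝ) ^ (-σ)) ^ Q := by
    refine summable_pow_mul_geometric_of_norm_lt_one 9 ?_
    rw [Real.norm_of_nonneg (by positivity)]
    exact two_mul_rpow_neg_lt_one hσ
  refine Summable.of_norm_bounded_eventually_nat (hgeom.mul_left (30 * 3 ^ σ)) ?_
  filter_upwards [eventually_ge_atTop 1] with Q hQ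
  have hcard : (rationalGrid (Q ^ 4) (Q * 2 ^ Q * Q ^ 4)).card ≤ 30 * Q ^ 9 * 2 ^ Q := by
    have hM : 1 ≤ Q ^ 4 := Nat.one_le_pow _ _ hQ
    have hD : 1 ≤ Q * 2 ^ Q * Q ^ 4 := Nat.succ_le_of_lt (by positivity)
    calc _ ≤ (Q ^ 4 + 1) * (14 * (Q * 2 ^ Q * Q ^ 4) + 1) := card_rationalGrid_le _ _
      _ ≤ (2 * Q ^ 4) * (15 * (Q * 2 ^ Q * Q ^ 4)) := by gcongr <;> omega
      _ = 30 * Q ^ 9 * 2 ^ Q := by ring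
  have hradius : (3 * ((4 : ℝ) ^ Q)⁻¹) ^ σ = 3 ^ σ * ((4 : ℝ) ^ (-σ)) ^ Q := by
    rw [Real.mul_rpow (by norm_num) (by positivity), Real.inv_rpow (by positivity),
      ← Real.rpow_natCast, ← Real.rpow_natCast, ← Real.rpow_mul (by norm_num),
      ← Real.rpow_mul (by norm_num), ← Real.rpow_neg (by norm_num)]
    ring_nf
  rw [Real.norm_of_nonneg (by positivity), hradius, mul_pow]
  calc _ ≤ (30 * Q ^ 9 * 2 ^ Q : ℝ) * (3 ^ σ * ((4 : ℝ) ^ (-σ)) ^ Q) := by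
        gcongr
        exact_mod_cast hcard
    _ = _ := by ring

/-- The point above `x` on the line `z = α * x + (s + √2 * α)`. These are the lines which
`projectiveMap` turns into lines of slope `s`. -/
noncomputable def chartLine (α s x : ℝ) : ℝ × ℝ := (x, α * x + (s + √2 * α))

variable {K : Set ℝ} {𝒬 : Set ℕ} {α : ℝ → ℝ}

theorem exists_mem_rationalGrid_dist_chartLine_le {α s x : ℝ} {Q : ℕ} (hQ : 0 < Q)
    (hα : α ∈ Set.Ioo (0 : ℝ) 1) (hs : s ∈ Set.Icc (-1 : ℝ) 1) (hx : x ∈ Set.Icc (0 : ℝ) 1)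
    (hxQ : ∃ u ≤ Q ^ 4, |x - u / (Q : ℝ) ^ 4| ≤ ((4 : ℝ) ^ Q)⁻¹)
    (hαQ : α ∈ approximableIntercepts s Q) :
    ∃ a ∈ rationalGrid (Q ^ 4) (Q * 2 ^ Q * Q ^ 4),
      dist (chartLine α s x) a ≤ 3 * ((4 : ℝ) ^ Q)⁻¹ := by
  obtain ⟨u, hu, hxu⟩ := hxQ
  obtain ⟨j, k, hj, hk⟩ := hαQ
  obtain ⟨h1, h2⟩ := sqrt_two_mem_Ioo
  have hb : |s + √2 * α| ≤ 3 := by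
    rw [abs_le]
    constructor <;> nlinarith [hα.1, hα.2, hs.1, hs.2]
  exact exists_mem_rationalGrid_dist_le (pow_pos hQ 4) (by positivity)
    (inv_le_one_of_one_le₀ (one_le_pow₀ (by norm_num)))
    (abs_le.2 ⟨by linarith [hx.1], hx.2⟩) (abs_le.2 ⟨by linarith [hα.1], hα.2.le⟩) hb hu
    (by exact_mod_cast hxu) (by exact_mod_cast hj.le) (by exact_mod_cast hk.le)

theorem dimH_image2_chartLine_le (hK : K ⊆ Set.Icc 0 1)
    (hK𝒬 : ∀ Q ∈ 𝒬, ∀ x ∈ K, ∃ u ≤ Q ^ 4, |x - u / (Q : ℝ) ^ 4| ≤ ((4 : ℝ) ^ Q)⁻¹)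
    (hα : ∀ s, α s ∈ Set.Ioo (0 : ℝ) 1)
    (hα𝒬 : ∀ s, ∃ᶠ Q in atTop, Q ∈ 𝒬 ∧ α s ∈ approximableIntercepts s Q) :
    dimH (Set.image2 (fun s x ↦ chartLine (α s) s x) (Set.Icc (-1) 1) K) ≤ 1 / 2 := by
  refine dimH_le fun d hd ↦ le_of_not_gt fun hlt ↦ ?_
  have hd' : (1 / 2 : ℝ) < d := by
    have : ((1 / 2 : ℝ≥0) : ℝ≥0∞) < d := by simpa using hlt
    exact_mod_cast ENNReal.coe_lt_coe.1 this
  have hzero := hausdorffMeasure_eq_zero_of_frequently_exists_dist_le (X := ℝ × ℝ)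
    (F := Set.image2 (fun s x ↦ chartLine (α s) s x) (Set.Icc (-1) 1) K)
    (by linarith) (fun Q : ℕ ↦ by positivity) (summable_card_rationalGrid_mul_rpow hd') ?_
  · exact ENNReal.top_ne_zero (hd.symm.trans hzero)
  · rintro _ ⟨s, hs, x, hx, rfl⟩
    refine ((hα𝒬 s).and_eventually (eventually_gt_atTop 0)).mono ?_
    rintro Q ⟨⟨hQ, hαQ⟩, hQ0⟩
    exact exists_mem_rationalGrid_dist_chartLine_le hQ0 (hα s) hs (hK hx) (hK𝒬 Q hQ x hx) hαQ

/-- The projective transformation `(x, z) ↦ (1 / (x + √2), z / (x + √2))`. -/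
noncomputable def projectiveMap (p : ℝ × ℝ) : ℝ² := !₂[(p.1 + √2)⁻¹, p.2 * (p.1 + √2)⁻¹]

theorem contDiffOn_projectiveMap : ContDiffOn ℝ 1 projectiveMap {p | -√2 < p.1} := by
  have hinv : ContDiffOn ℝ 1 (fun p : ℝ × ℝ ↦ (p.1 + √2)⁻¹) {p | -√2 < p.1} :=
    (contDiff_fst.add contDiff_const).contDiffOn.inv fun p hp ↦
      (neg_lt_iff_pos_add.1 hp).ne'
  refine contDiffOn_euclidean.2 fun i ↦ ?_
  fin_cases i
  · exact hinv
  · exact contDiff_snd.contDiffOn.mul hinv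

theorem dimH_image_projectiveMap_le {F : Set (ℝ × ℝ)} (hF : ∀ p ∈ F, 0 ≤ p.1) :
    dimH (projectiveMap '' F) ≤ dimH F := by
  have hconvex : Convex ℝ {p : ℝ × ℝ | -√2 < p.1} :=
    convex_halfSpace_gt (LinearMap.fst ℝ ℝ ℝ).isLinear _
  have hneg : -√2 < 0 := neg_lt_zero.2 (by positivity)
  exact contDiffOn_projectiveMap.dimH_image_le hconvex fun p hp ↦ hneg.trans_le (hF p hp)

theorem projectiveMap_chartLine_mem_lineWithSlope {α s x : ℝ} (hx : 0 ≤ x) :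
    projectiveMap (chartLine α s x) ∈ lineWithSlope s α := by
  have : x + √2 ≠ 0 := by positivity
  simp only [projectiveMap, chartLine, lineWithSlope, Set.mem_ofPred_eq,
    Matrix.cons_val_zero, Matrix.cons_val_one]
  field_simp
  ring

end ProjectiveChart

section UpperBound

variable {h : ℝ≥0 → ℝ≥0} {E : Set ℝ²}

theorem pos_of_isBigO (hmono : Monotone h)
    (hlog : (fun x : ℝ≥0 ↦ 1 / Real.log (1 / (x : ℝ))) =O[𝓝[>] 0] fun x ↦ (h x : ℝ)) {x : ℝ≥0}
    (hx : 0 < x) : 0 < h x := by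
  obtain ⟨C, hC⟩ := hlog.bound
  obtain ⟨y, ⟨hy, hyx, hy1⟩, hy0⟩ := ((hC.and (eventually_nhdsWithin_of_eventually_nhds
    ((eventually_lt_nhds hx).and (eventually_lt_nhds one_pos)))).and self_mem_nhdsWithin).exists
  have hlog_pos : 0 < Real.log (1 / (y : ℝ)) :=
    Real.log_pos (one_lt_one_div (NNReal.coe_pos.2 hy0) (by exact_mod_cast hy1))
  refine (pos_iff_ne_zero.2 fun hzero ↦ ?_).trans_le (hmono hyx.le)
  rw [hzero, NNReal.coe_zero, norm_zero, mul_zero, norm_le_zero_iff] at hy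
  exact (one_div_pos.2 hlog_pos).ne' hy

theorem exists_one_div_le_mul_inv_pow (hmono : Monotone h)
    (hlog : (fun x : ℝ≥0 ↦ 1 / Real.log (1 / (x : ℝ))) =O[𝓝[>] 0] fun x ↦ (h x : ℝ)) {b : ℝ≥0}
    (hb : 1 < b) : ∃ C : ℝ≥0, 0 < C ∧ ∀ k : ℕ, (1 : ℝ) / (k + 1) ≤ C * h (b ^ k)⁻¹ := by
  have hpow : Tendsto (fun k : ℕ ↦ (b ^ k)⁻¹) atTop (𝓝[>] 0) :=
    tendsto_nhdsWithin_iff.2 ⟨(tendsto_pow_atTop_atTop_of_one_lt hb).inv_tendsto_atTop,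
      Eventually.of_forall fun k ↦ inv_pos.2 (pow_pos (zero_lt_one.trans hb) k)⟩
  have hb' : 0 < Real.log b := Real.log_pos (by exact_mod_cast hb)
  have hharmonic : (fun k : ℕ ↦ (1 : ℝ) / (k + 1)) =O[atTop]
      fun k ↦ 1 / Real.log (1 / ((b ^ k)⁻¹ : ℝ≥0)) := by
    refine IsBigO.of_bound (Real.log b) ?_
    filter_upwards [eventually_ge_atTop 1] with k hk
    have hk' : (0 : ℝ) < k := by exact_mod_cast hk
    rw [NNReal.coe_inv, NNReal.coe_pow, one_div (_ ^ k)⁻¹, inv_inv, Real.log_pow,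
      Real.norm_of_nonneg (by positivity), Real.norm_of_nonneg (by positivity), mul_one_div,
      mul_comm (k : ℝ), div_mul_cancel_left₀ hb'.ne', ← one_div]
    exact one_div_le_one_div_of_le hk' (by linarith)
  obtain ⟨C, hC, hbound⟩ := bound_of_isBigO_nat_atTop (hharmonic.trans (hlog.comp_tendsto hpow))
  refine ⟨⟨C, hC.le⟩, hC, fun k ↦ ?_⟩
  have hpos : 0 < h (b ^ k)⁻¹ :=
    pos_of_isBigO hmono hlog (inv_pos.2 (pow_pos (zero_lt_one.trans hb) k))
  have hk := hbound (x := k) (NNReal.coe_ne_zero.2 hpos.ne')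
  rwa [Real.norm_of_nonneg (by positivity), Function.comp_apply,
    Real.norm_of_nonneg (NNReal.coe_nonneg _)] at hk

theorem exists_inv_pow_le_abs_inv_spread_sub {y y' : ℝ} (hy : y ∈ Set.Ico (0 : ℝ) 1)
    (hy' : y' ∈ Set.Ico (0 : ℝ) 1) (hne : y ≠ y') :
    ∃ k : ℕ, |y - y'| ≤ 6 * (1 / (k + 1)) ∧ ((4 : ℝ) ^ k)⁻¹ ≤
      |(spread freePositions y + √2)⁻¹ - (spread freePositions y' + √2)⁻¹| := by
  classical
  obtain ⟨k, hyk, hk⟩ := exists_le_abs_spread_sub infinite_freePositions hy hy' hne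
  obtain ⟨h1, h2⟩ := sqrt_two_mem_Ioo
  obtain ⟨hx0, hx1⟩ := spread_mem_Icc (S := freePositions) y
  obtain ⟨hx0', hx1'⟩ := spread_mem_Icc (S := freePositions) y'
  set x := spread freePositions y
  set x' := spread freePositions y'
  refine ⟨k + 3, hyk.trans ?_, ?_⟩
  · have hcount : k + 4 ≤ 6 * 2 ^ Nat.count (· ∈ freePositions) k := by
      have := le_two_mul_two_pow_count k
      have := Nat.one_le_two_pow (n := Nat.count (· ∈ freePositions) k)
      omega
    have hcount' : (k : ℝ) + 4 ≤ 6 * 2 ^ Nat.count (· ∈ freePositions) k := by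
      exact_mod_cast hcount
    rw [inv_eq_one_div, mul_one_div, div_le_div_iff₀ (by positivity) (by positivity)]
    push_cast
    linarith
  · have hprod : (x + √2) * (x' + √2) ≤ 8 := by nlinarith
    have hpos : 0 < (x + √2) * (x' + √2) := by positivity
    rw [inv_sub_inv (by positivity) (by positivity), abs_div, abs_of_pos hpos, le_div_iff₀ hpos,
      add_sub_add_right_eq_sub, abs_sub_comm]
    calc ((4 : ℝ) ^ (k + 3))⁻¹ * ((x + √2) * (x' + √2)) ≤ ((4 : ℝ) ^ (k + 3))⁻¹ * 8 := by gcongr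
      _ = ((4 : ℝ) ^ k)⁻¹ / 8 := by
        rw [pow_add]
        field_simp
        norm_num
      _ ≤ |x - x'| := hk

theorem hausdorffOuterMeasure_image_pos (hmono : Monotone h)
    (hlog : (fun x : ℝ≥0 ↦ 1 / Real.log (1 / (x : ℝ))) =O[𝓝[>] 0] fun x ↦ (h x : ℝ)) {G : ℝ → ℝ²}
    (hG : ∀ y, G y 0 = (spread freePositions y + √2)⁻¹) :
    0 < hausdorffOuterMeasure h (G '' Set.Ico 0 1) := by
  obtain ⟨C, hC, hCh⟩ := exists_one_div_le_mul_inv_pow hmono hlog (b := 4) (by norm_num)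
  have hmod (y : ℝ) (hy : y ∈ Set.Ico (0 : ℝ) 1) (y' : ℝ) (hy' : y' ∈ Set.Ico (0 : ℝ) 1) :
      edist y y' ≤ (6 * C : ℝ≥0) * (h (edist (G y) (G y')).toNNReal : ℝ≥0∞) := by
    rcases eq_or_ne y y' with rfl | hne
    · simp
    obtain ⟨k, hyk, hk⟩ := exists_inv_pow_le_abs_inv_spread_sub hy hy' hne
    have hdist : ((4 : ℝ≥0) ^ k)⁻¹ ≤ nndist (G y) (G y') := by
      rw [← hG, ← hG, ← Real.dist_eq] at hk
      exact_mod_cast hk.trans (PiLp.dist_apply_le (G y) (G y') 0)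
    rw [edist_nndist, edist_nndist, ENNReal.toNNReal_coe, ← ENNReal.coe_mul, ENNReal.coe_le_coe,
      ← NNReal.coe_le_coe, coe_nndist, Real.dist_eq, NNReal.coe_mul]
    calc |y - y'| ≤ 6 * (1 / (k + 1)) := hyk
      _ ≤ 6 * (C * h ((4 : ℝ≥0) ^ k)⁻¹) := by gcongr; exact hCh k
      _ ≤ 6 * (C * h (nndist (G y) (G y'))) := by gcongr; exact hmono hdist
      _ = _ := by push_cast; ring
  have hvolume := volume_le_mul_mkMetric_image (m := fun r ↦ (h r.toNNReal : ℝ≥0∞))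
    (fun r _ r' hr' hrr' ↦ ENNReal.coe_le_coe.2 (hmono (ENNReal.toNNReal_mono hr'.ne hrr')))
    (mul_ne_zero (by norm_num) hC.ne') hmod
  refine pos_iff_ne_zero.2 fun hzero ↦ ?_
  rw [hausdorffOuterMeasure] at hzero
  simp [hzero] at hvolume

theorem isFurstenbergDirection_projectiveMap_image (hmono : Monotone h)
    (hlog : (fun x : ℝ≥0 ↦ 1 / Real.log (1 / (x : ℝ))) =O[𝓝[>] 0] fun x ↦ (h x : ℝ))
    {F : Set (ℝ × ℝ)} {α s : ℝ} (hF : ∀ y, chartLine α s (spread freePositions y) ∈ F) :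
    IsFurstenbergDirection h (projectiveMap '' F) !₂[1, s] := by
  refine isFurstenbergDirection_of_lineWithSlope (b := α) zero_lt_one
    ((hausdorffOuterMeasure_image_pos hmono hlog
      (G := fun y ↦ projectiveMap (chartLine α s (spread freePositions y)))
      fun y ↦ rfl).trans_le (measure_mono ?_))
  rintro _ ⟨y, -, rfl⟩
  have hx := (spread_mem_Icc (S := freePositions) y).1
  have hden : 1 ≤ spread freePositions y + √2 :=
    le_add_of_nonneg_of_le hx sqrt_two_mem_Ioo.1.le
  exact ⟨⟨Set.mem_image_of_mem _ (hF y), projectiveMap_chartLine_mem_lineWithSlope hx⟩,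
    inv_nonneg.2 (zero_le_one.trans hden), inv_le_one_of_one_le₀ hden⟩

/-- The reflection of the plane in the diagonal. -/
noncomputable def coordSwap : ℝ² ≃ₗᵢ[ℝ] ℝ² :=
  LinearIsometryEquiv.piLpCongrLeft 2 ℝ ℝ (Equiv.swap 0 1)

theorem coordSwap_toLp (a b : ℝ) : coordSwap !₂[a, b] = !₂[b, a] := by
  ext i
  fin_cases i <;> rfl

theorem IsFurstenbergDirection.of_abs_le {a b : ℝ} (ha : a ≠ 0) (hab : |b| ≤ |a|)
    (hE : ∀ s ∈ Set.Icc (-1 : ℝ) 1, IsFurstenbergDirection h E !₂[1, s]) :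
    IsFurstenbergDirection h E !₂[a, b] := by
  have hslope : b / a ∈ Set.Icc (-1 : ℝ) 1 := by
    rw [Set.mem_Icc, ← abs_le, abs_div]
    exact div_le_one_of_le₀ hab (abs_nonneg a)
  have hsmul : a • !₂[1, b / a] = !₂[a, b] := by
    ext i
    fin_cases i
    · simp
    · simp [mul_div_cancel₀ b ha]
  exact hsmul ▸ (hE _ hslope).smul ha

theorem isFurstenbergSet_union_coordSwap_image
    (hE : ∀ s ∈ Set.Icc (-1 : ℝ) 1, IsFurstenbergDirection h E !₂[1, s]) :
    IsFurstenbergSet h (E ∪ coordSwap '' E) := by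
  refine isFurstenbergSet_iff.2 fun v hv ↦ ?_
  obtain ⟨a, b, rfl⟩ : ∃ a b, v = !₂[a, b] := ⟨v 0, v 1, by ext i; fin_cases i <;> rfl⟩
  rcases le_total |b| |a| with hab | hab
  · have ha : a ≠ 0 := by
      rintro rfl
      simp_all
    exact (IsFurstenbergDirection.of_abs_le ha hab hE).mono Set.subset_union_left
  · have hb : b ≠ 0 := by
      rintro rfl
      simp_all
    rw [← coordSwap_toLp]
    exact ((IsFurstenbergDirection.of_abs_le hb hab hE).image coordSwap).mono
      Set.subset_union_right

theorem exists_isFurstenbergSet_dimH_le (hmono : Monotone h)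
    (hlog : (fun x : ℝ≥0 ↦ 1 / Real.log (1 / (x : ℝ))) =O[𝓝[>] 0] fun x ↦ (h x : ℝ)) :
    ∃ E : Set ℝ², IsFurstenbergSet h E ∧ dimH E ≤ 1 / 2 := by
  choose α hα hα𝒬 using exists_frequently_mem_approximableIntercepts infinite_gapScales
  let K := Set.range (spread freePositions)
  have hK : K ⊆ Set.Icc 0 1 := Set.range_subset_iff.2 spread_mem_Icc
  have hK𝒬 : ∀ Q ∈ gapScales, ∀ x ∈ K,
      ∃ u ≤ Q ^ 4, |x - u / (Q : ℝ) ^ 4| ≤ ((4 : ℝ) ^ Q)⁻¹ :=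
    fun Q hQ ↦ Set.forall_mem_range.2 (exists_nat_abs_spread_sub_le hQ)
  let F := Set.image2 (fun s x ↦ chartLine (α s) s x) (Set.Icc (-1) 1) K
  have hdim : dimH (projectiveMap '' F) ≤ 1 / 2 := by
    refine (dimH_image_projectiveMap_le ?_).trans (dimH_image2_chartLine_le hK hK𝒬 hα hα𝒬)
    rintro _ ⟨s, -, x, hx, rfl⟩
    exact (hK hx).1
  refine ⟨projectiveMap '' F ∪ coordSwap '' (projectiveMap '' F),
    isFurstenbergSet_union_coordSwap_image fun s hs ↦
      isFurstenbergDirection_projectiveMap_image hmono hlog fun y ↦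
        Set.mem_image2_of_mem hs (Set.mem_range_self y), ?_⟩
  rw [dimH_union, coordSwap.isometry.dimH_image, max_self]
  exact hdim

end UpperBound

theorem mainTheorem4_general (h : ℝ≥0 → ℝ≥0) (hmono : Monotone h)
    (hlog : (fun x : ℝ≥0 ↦ (h x : ℝ)) =Θ[𝓝[>] 0] fun x ↦ 1 / Real.log (1 / (x : ℝ))) :
    (∃ E : Set (EuclideanSpace ℝ (Fin 2)), IsFurstenbergSet h E ∧ dimH E ≤ 1 / 2) ∧
      (∀ E : Set (EuclideanSpace ℝ (Fin 2)), IsFurstenbergSet h E → 1 / 2 ≤ dimH E) :=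
  ⟨exists_isFurstenbergSet_dimH_le hmono hlog.2,
    fun _ hE ↦ hE.one_half_le_dimH hmono hlog.1⟩

theorem mainTheorem4 (h : ℝ≥0 → ℝ≥0) (hdim : IsDimensionFunction h)
    (hlog : IsInverseLogNearZero h) :
    (∃ E : Set (EuclideanSpace ℝ (Fin 2)), IsFurstenbergSet h E ∧ dimH E ≤ 1 / 2) ∧
      (∀ E : Set (EuclideanSpace ℝ (Fin 2)), IsFurstenbergSet h E → 1 / 2 ≤ dimH E) :=
  mainTheorem4_general h hdim.mono (EventuallyEq.isTheta hlog)
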